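/- **Model.** A ring has $n\ge 3$ anonymous nodes $v_0,\dots,v_{n-1}$ and an edge joining $v_i$ and $v_{i+1}$ for each $i$ (indices modulo $n$). Time is divided into synchronous rounds $0,1,2,\dots$; in each round an adversary may remove at most one edge, with no fairness restriction. There are $k$ anonymous, silent agents, which start in the same initial state at $k$ distinct nodes (the homebases), all execute the same deterministic algorithm and have unbounded local memory. Homebases carry identical marks. Inside a node an agent is at the node itself or in the incoming or outgoing buffer of one of the two ports. At the beginning of a round an agent that has not terminated perceives whether its node is a homebase, its own place in the node, how many other agents are in each place of its node, and (*cross detection*) whether, in the previous round, it traversed an edge that another agent traversed in the opposite direction. From this and its memory it computes its new memory and either enters the terminal state or chooses a direction left, right or nil. With direction nil, or if terminated, it stays at the node itself. Otherwise it goes to the outgoing buffer of the chosen port; if the corresponding edge is present it arrives at the beginning of the next round in the incoming buffer of the other endpoint of that edge, and if the edge is missing it remains in the outgoing buffer. Terminated agents never move or act again. *Chirality* means that all agents agree on which direction of the ring is left and which is right. Knowledge of $n$ (of $k$) means that the algorithm receives this number as input, and nothing else about $n$, $k$ and the configuration. **Configurations.** A configuration $C\in\mathcal C$ is the set of homebases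 $h_0,\dots,h_{k-1}$, listed clockwise; $d_i$ is the clockwise distance from $h_i$ to $h_{i+1}$ (indices modulo $k$). It is periodic, $C\in\mathcal P$, if for some $p$ with $0<p<k$ and $p\mid k$ we have $d_i=d_{i+p}$ for all $i$. **Gathering.** The agents are gathered in a round if all of them are on the same node or on two neighbouring nodes. An algorithm solves Gathering within $T$ rounds in an execution if by round $T$ all agents are in the terminal state and are gathered, and in every round in which some agent is in the terminal state gathering is achieved (so that an agent that terminates is aware of gathering). **Theorem.** With chirality and cross detection, and with knowledge of either $n$ or $k$, Gathering is solvable in $O(n)$ rounds from every configuration $C\in\mathcal C\setminus\mathcal P$. That is: 1. there are an algorithm that knows $n$ but not $k$, and a constant $c$, such that for all $n\ge 3$, all $k$, every configuration $C\in\mathcal C\setminus\mathcal P$ of $k$ homebases in the ring of size $n$, every common orientation of the agents and every choice of the missing edges by the adversary, the algorithm solves Gathering within $cn$ rounds; 2. there are an algorithm that knows $k$ but not $n$, and a constant $c$, with the same property. -/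

import Mathlib

/-! Gathering of anonymous silent agents in a 1-interval-connected dynamic ring.

The nodes of the ring are the elements of `ZMod n`; node `v` has a port `minus` leading to `v - 1`
and a port `plus` leading to `v + 1` (the clockwise direction). -/

namespace DynRing

/-- The two ports of a node, as seen by an external observer. -/
inductive Port where
  | minus
  | plus
  deriving DecidableEq

/-- The names that an agent gives to the two ports of a node. -/
inductive Side where
  | left
  | right
  deriving DecidableEq

/-- The places inside a node: the node itself, and the incoming and the outgoing buffer of each
of its two ports (`P` is the type of names of the ports). -/
inductive Place (P : Type) where
  | node
  | inb (p : P)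
  | outb (p : P)
  deriving DecidableEq

/-- Rename the ports. -/
def Place.map {P Q : Type} (f : P → Q) : Place P → Place Q
  | .node => .node
  | .inb p => .inb (f p)
  | .outb p => .outb (f p)

/-- What an agent perceives at the beginning of a round: whether its node is marked as a homebase;
whether in the previous round it crossed somebody on the edge that it traversed (cross detection);
its own place in the node; and the number of *other* agents in each place of the node.  Sides are
named by the agent's own orientation. -/
structure Obs where
  homebase : Bool
  crossed : Bool
  place : Place Side
  atNode : ℕ
  inLeft : ℕ
  inRight : ℕ
  outLeft : ℕ
  outRight : ℕ

/-! Encodings of the finite data above, so that computability of a protocol makes sense. -/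

def Side.equivBool : Side ≃ Bool where
  toFun | .left => false | .right => true
  invFun | false => .left | true => .right
  left_inv := by rintro (_ | _) <;> rfl
  right_inv := by rintro (_ | _) <;> rfl

instance : Primcodable Side := Primcodable.ofEquiv Bool Side.equivBool

def Place.equivOption (P : Type) : Place P ≃ Option (P ⊕ P) where
  toFun | .node => none | .inb p => some (.inl p) | .outb p => some (.inr p)
  invFun | none => .node | some (.inl p) => .inb p | some (.inr p) => .outb p
  left_inv := by rintro (_ | _ | _) <;> rfl
  right_inv := by rintro (_ | _ | _) <;> rfl

instance {P : Type} [Primcodable P] : Primcodable (Place P) :=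
  Primcodable.ofEquiv (Option (P ⊕ P)) (Place.equivOption P)

def Obs.equivProd : Obs ≃ Bool × Bool × Place Side × ℕ × ℕ × ℕ × ℕ × ℕ where
  toFun o := (o.homebase, o.crossed, o.place, o.atNode, o.inLeft, o.inRight, o.outLeft, o.outRight)
  invFun x := ⟨x.1, x.2.1, x.2.2.1, x.2.2.2.1, x.2.2.2.2.1, x.2.2.2.2.2.1, x.2.2.2.2.2.2.1,
    x.2.2.2.2.2.2.2⟩
  left_inv _ := rfl
  right_inv _ := rfl

instance : Primcodable Obs := Primcodable.ofEquiv _ Obs.equivProd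

/-- A deterministic protocol, executed by every agent.  `step κ m o` is what an agent does in a
round, when `κ` is the number that it was given at the start (the ring size, or the number of
agents), `m` the content of its memory (system state included) and `o` its current observation:
`none` means that it enters the terminal state, and `some (m', d)` that its memory becomes `m'` and
its direction is `d` (`none` is `nil`).  The step has to be an effectively computable function. -/
structure Protocol where
  Mem : Type
  [primcodable : Primcodable Mem]
  init : Mem
  step : ℕ → Mem → Obs → Option (Mem × Option Side)
  computable_step : Computable fun x : ℕ × Mem × Obs => step x.1 x.2.1 x.2.2

/-- A configuration of `k` homebases in the ring of size `n`: distinct nodes, listed in clockwise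
order starting from node `0`. -/
structure Config (n k : ℕ) where
  home : Fin k → ZMod n
  strictMono : StrictMono fun i => (home i).val

/-- The distance from the `i`-th homebase clockwise to the next one, indices modulo `k`. -/
def Config.gap {n k : ℕ} (C : Config n k) (i : Fin k) : ℕ :=
  if h : (i : ℕ) + 1 < k then (C.home ⟨i + 1, h⟩).val - (C.home i).val
  else n + (C.home ⟨0, i.pos⟩).val - (C.home i).val

/-- Periodic configurations: for a proper divisor `p` of `k`, the sequence of distances is
invariant under a shift of the indices (modulo `k`) by `p`. -/
def Config.IsPeriodic {n k : ℕ} (C : Config n k) : Prop :=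
  ∃ p, 0 < p ∧ p < k ∧ p ∣ k ∧ ∀ i : Fin k, C.gap i = C.gap ⟨(i + p) % k, Nat.mod_lt _ i.pos⟩

/-- Private orientations of the agents: each one names the two ports `left` and `right`,
consistently at all nodes. -/
abbrev Orientations (k : ℕ) := Fin k → (Port ≃ Side)

/-- Chirality: all agents agree on the orientation. -/
def Chirality {k : ℕ} (lam : Orientations k) : Prop := ∀ i j, lam i = lam j

/-- A choice of the adversary: in each round, at most one missing edge.  Edge `v` joins the nodes
`v` and `v + 1`. -/
abbrev Schedule (n : ℕ) := ℕ → Option (ZMod n)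

def Port.opp : Port → Port
  | .minus => .plus
  | .plus => .minus

/-- The edge at the port `p` of the node `v`. -/
def edgeAt {n : ℕ} (v : ZMod n) : Port → ZMod n
  | .minus => v - 1
  | .plus => v

/-- The neighbour of `v` through the port `p`. -/
def neighbour {n : ℕ} (v : ZMod n) : Port → ZMod n
  | .minus => v - 1
  | .plus => v + 1

/-- The situation of an agent at the beginning of a round; `mem = none` is the terminal state. -/
structure Agent (n : ℕ) (M : Type) where
  mem : Option M
  pos : ZMod n
  place : Place Port
  crossed : Bool

section Dynamics

variable {n k : ℕ} (A : Protocol) (κ : ℕ) (C : Config n k) (lam : Orientations k)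

/-- The number of agents other than `i` that are in the node of `i`, in the place that `i` calls
`q`. -/
def countOthers {M : Type} (w : Fin k → Agent n M) (i : Fin k) (q : Place Side) : ℕ :=
  (Finset.univ.filter fun j =>
    j ≠ i ∧ (w j).pos = (w i).pos ∧ (w j).place.map (lam i) = q).card

def observe {M : Type} (w : Fin k → Agent n M) (i : Fin k) : Obs where
  homebase := decide (∃ a, C.home a = (w i).pos)
  crossed := (w i).crossed
  place := (w i).place.map (lam i)
  atNode := countOthers lam w i .node
  inLeft := countOthers lam w i (.inb .left)
  inRight := countOthers lam w i (.inb .right)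
  outLeft := countOthers lam w i (.outb .left)
  outRight := countOthers lam w i (.outb .right)

/-- What agent `i` computes in a round; a terminated agent computes nothing. -/
def decision (w : Fin k → Agent n A.Mem) (i : Fin k) : Option (A.Mem × Option Side) :=
  (w i).mem.bind fun m => A.step κ m (observe C lam w i)

/-- The port through which agent `i` tries to leave its node in this round, if any.  An agent that
has terminated, or that terminates in this round, does not try to move. -/
def intent (w : Fin k → Agent n A.Mem) (i : Fin k) : Option Port :=
  ((decision A κ C lam w i).bind Prod.snd).map (lam i).symm

/-- One round, in which the edge `e` is missing (no edge, if `e = none`).  An agent with direction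
`nil` places itself at the node.  The other ones go to the outgoing buffer of the chosen port and,
unless the edge is missing, they arrive in the incoming buffer of the neighbour's port of that
edge; an agent then detects whether some agent traversed the edge in the opposite direction. -/
def nextRound (e : Option (ZMod n)) (w : Fin k → Agent n A.Mem) (i : Fin k) : Agent n A.Mem :=
  let m := (decision A κ C lam w i).map Prod.fst
  match intent A κ C lam w i with
  | none => ⟨m, (w i).pos, .node, false⟩
  | some p =>
    if e = some (edgeAt (w i).pos p) then ⟨m, (w i).pos, .outb p, false⟩
    else ⟨m, neighbour (w i).pos p, .inb p.opp,
      decide (∃ j, intent A κ C lam w j = some p.opp ∧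
        edgeAt (w j).pos p.opp = edgeAt (w i).pos p)⟩

/-- The execution: at the beginning of round `0` every agent is in its initial state at its own
homebase. -/
def run (missing : Schedule n) : ℕ → Fin k → Agent n A.Mem
  | 0 => fun i => ⟨some A.init, C.home i, .node, false⟩
  | t + 1 => nextRound A κ C lam (missing t) (run missing t)

end Dynamics

/-- All agents are on the same node or on two neighbouring nodes. -/
def Gathered {n k : ℕ} {M : Type} (w : Fin k → Agent n M) : Prop :=
  ∃ v : ZMod n, ∀ i, (w i).pos = v ∨ (w i).pos = v + 1

/-- Gathering is solved within `T` rounds: by round `T` all agents are in the terminal state and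
gathered; and the terminal state certifies gathering, that is, gathering is achieved
in every round in which some agent is in the terminal state. -/
def SolvesGathering {n k : ℕ} (A : Protocol) (κ : ℕ) (C : Config n k) (lam : Orientations k)
    (missing : Schedule n) (T : ℕ) : Prop :=
  (∃ t ≤ T, (∀ i, (run A κ C lam missing t i).mem = none) ∧ Gathered (run A κ C lam missing t)) ∧
  ∀ t i, (run A κ C lam missing t i).mem = none → Gathered (run A κ C lam missing t)

end DynRing

namespace DynRing

/-- What an agent has recorded of the bits (homebase or not) of the nodes it has visited. -/
structure Registers where
  moves : ℕ
  ones : ℕ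
  size : ℕ
  word : ℕ
  best : ℕ
  target : ℕ

/-- The memory of an agent: the number of the current round, and its registers. -/
structure Memory where
  clock : ℕ
  regs : Registers

def Registers.equivProd : Registers ≃ ℕ × ℕ × ℕ × ℕ × ℕ × ℕ where
  toFun R := (R.moves, R.ones, R.size, R.word, R.best, R.target)
  invFun x := ⟨x.1, x.2.1, x.2.2.1, x.2.2.2.1, x.2.2.2.2.1, x.2.2.2.2.2⟩
  left_inv _ := rfl
  right_inv _ := rfl

instance : Primcodable Registers := Primcodable.ofEquiv _ Registers.equivProd

def Memory.equivProd : Memory ≃ ℕ × Registers where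
  toFun m := (m.clock, m.regs)
  invFun x := ⟨x.1, x.2⟩
  left_inv _ := rfl
  right_inv _ := rfl

instance : Primcodable Memory := Primcodable.ofEquiv _ Memory.equivProd

namespace Registers

/-- The ring size as far as it is known, and `0` otherwise.  The agents are given the ring size
if `b` is true, and the number of agents if `b` is false. -/
def ringSize (b : Bool) (κ : ℕ) (R : Registers) : ℕ := if b = true then κ else R.size

/-- The registers after one more step to a node with bit `x`. -/
def advance (b : Bool) (κ : ℕ) (R : Registers) (x : Bool) : Registers :=
  let moves := R.moves + 1
  let ones := R.ones + x.toNat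
  let size := if R.size = 0 ∧ ones = κ then moves else R.size
  let word := 2 * R.word + x.toNat
  let N := if b = true then κ else size
  if N < moves ∧ moves ≤ 2 * N ∧ R.best < word % 2 ^ N then
    ⟨moves, ones, size, word, word % 2 ^ N, moves + N⟩
  else ⟨moves, ones, size, word, R.best, R.target⟩

/-- The agent has reached the elected node for good. -/
def Arrived (b : Bool) (κ : ℕ) (R : Registers) : Prop :=
  R.moves = R.target ∧ 2 * R.ringSize b κ < R.moves

instance (b : Bool) (κ : ℕ) (R : Registers) : Decidable (R.Arrived b κ) :=
  inferInstanceAs (Decidable (_ ∧ _))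

end Registers

/-- The registers after the observation `o` has been taken into account. -/
def Memory.refresh (b : Bool) (κ : ℕ) (m : Memory) (o : Obs) : Registers :=
  if o.place = .inb .right ∧
      ¬ (m.regs.ringSize b κ ≠ 0 ∧ 7 * m.regs.ringSize b κ < m.clock) then
    m.regs.advance b κ o.homebase
  else m.regs

/-- The number of other agents in the node. -/
def Obs.others (o : Obs) : ℕ := o.atNode + o.inLeft + o.inRight + o.outLeft + o.outRight

/-- An agent going right sees an agent going left, or conversely. -/
def MeetsOpposite (arrived : Prop) (o : Obs) : Prop :=
  (arrived ∧ 0 < o.inRight + o.outLeft) ∨ (¬ arrived ∧ 0 < o.inLeft + o.outRight)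

instance (p : Prop) [Decidable p] (o : Obs) : Decidable (MeetsOpposite p o) :=
  inferInstanceAs (Decidable (_ ∨ _))

/-- The condition for an agent to terminate in round `t`. -/
def Halts (b : Bool) (κ t : ℕ) (R : Registers) (o : Obs) : Prop :=
  (b = false ∧ o.others + 1 = κ) ∨
    (R.ringSize b κ ≠ 0 ∧ (8 * R.ringSize b κ ≤ t ∨
      (7 * R.ringSize b κ < t ∧ (o.crossed = true ∨ MeetsOpposite (R.Arrived b κ) o))))

instance (b : Bool) (κ t : ℕ) (R : Registers) (o : Obs) : Decidable (Halts b κ t R o) :=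
  inferInstanceAs (Decidable (_ ∨ _))

/-- The direction of a non-terminating agent in round `t`. -/
def direction (b : Bool) (κ t : ℕ) (R : Registers) : Option Side :=
  if R.Arrived b κ then if 7 * R.ringSize b κ ≤ t then some .right else none else some .left

def gatherStep (b : Bool) (κ : ℕ) (m : Memory) (o : Obs) : Option (Memory × Option Side) :=
  if Halts b κ m.clock (m.refresh b κ o) o then none
  else some (⟨m.clock + 1, m.refresh b κ o⟩, direction b κ m.clock (m.refresh b κ o))

section Computability

variable {α : Type*} [Primcodable α]

theorem primrec_obs : Primrec Obs.equivProd := Primrec.of_equiv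

theorem primrec_registers : Primrec Registers.equivProd := Primrec.of_equiv

theorem primrec_memory : Primrec Memory.equivProd := Primrec.of_equiv

theorem primrec_memory_symm : Primrec Memory.equivProd.symm := Primrec.of_equiv_symm

theorem primrec_mk_registers {f₁ f₂ f₃ f₄ f₅ f₆ : α → ℕ} (h₁ : Primrec f₁) (h₂ : Primrec f₂)
    (h₃ : Primrec f₃) (h₄ : Primrec f₄) (h₅ : Primrec f₅) (h₆ : Primrec f₆) :
    Primrec fun a => Registers.mk (f₁ a) (f₂ a) (f₃ a) (f₄ a) (f₅ a) (f₆ a) :=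
  Primrec.of_eq ((Primrec.of_equiv_symm (e := Registers.equivProd)).comp
    (h₁.pair (h₂.pair (h₃.pair (h₄.pair (h₅.pair h₆)))))) fun _ => rfl

theorem primrec_moves : Primrec Registers.moves :=
  Primrec.of_eq (Primrec.fst.comp primrec_registers) fun _ => rfl

theorem primrec_ones : Primrec Registers.ones :=
  Primrec.of_eq (Primrec.fst.comp (Primrec.snd.comp primrec_registers)) fun _ => rfl

theorem primrec_size : Primrec Registers.size :=
  Primrec.of_eq (Primrec.fst.comp (Primrec.snd.comp (Primrec.snd.comp primrec_registers))) fun _ => rfl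

theorem primrec_word : Primrec Registers.word :=
  Primrec.of_eq (Primrec.fst.comp (Primrec.snd.comp (Primrec.snd.comp (Primrec.snd.comp primrec_registers)))) fun _ => rfl

theorem primrec_best : Primrec Registers.best :=
  Primrec.of_eq (Primrec.fst.comp (Primrec.snd.comp (Primrec.snd.comp (Primrec.snd.comp (Primrec.snd.comp
    primrec_registers))))) fun _ => rfl

theorem primrec_target : Primrec Registers.target :=
  Primrec.of_eq (Primrec.snd.comp (Primrec.snd.comp (Primrec.snd.comp (Primrec.snd.comp (Primrec.snd.comp
    primrec_registers))))) fun _ => rfl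

theorem primrec_clock : Primrec Memory.clock :=
  Primrec.of_eq (Primrec.fst.comp primrec_memory) fun _ => rfl

theorem primrec_regs : Primrec Memory.regs :=
  Primrec.of_eq (Primrec.snd.comp primrec_memory) fun _ => rfl

theorem primrec_homebase : Primrec Obs.homebase :=
  Primrec.of_eq (Primrec.fst.comp primrec_obs) fun _ => rfl

theorem primrec_crossed : Primrec Obs.crossed :=
  Primrec.of_eq (Primrec.fst.comp (Primrec.snd.comp primrec_obs)) fun _ => rfl

theorem primrec_place : Primrec Obs.place :=
  Primrec.of_eq (Primrec.fst.comp (Primrec.snd.comp (Primrec.snd.comp primrec_obs))) fun _ => rfl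

theorem primrec_counts : Primrec fun o : Obs =>
    (o.atNode, o.inLeft, o.inRight, o.outLeft, o.outRight) :=
  Primrec.of_eq (Primrec.snd.comp (Primrec.snd.comp (Primrec.snd.comp primrec_obs))) fun _ => rfl

theorem primrec_inLeft : Primrec Obs.inLeft :=
  Primrec.of_eq (Primrec.fst.comp (Primrec.snd.comp primrec_counts)) fun _ => rfl

theorem primrec_inRight : Primrec Obs.inRight :=
  Primrec.of_eq (Primrec.fst.comp (Primrec.snd.comp (Primrec.snd.comp primrec_counts))) fun _ => rfl

theorem primrec_outLeft : Primrec Obs.outLeft :=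
  Primrec.of_eq (Primrec.fst.comp (Primrec.snd.comp (Primrec.snd.comp (Primrec.snd.comp primrec_counts)))) fun _ => rfl

theorem primrec_outRight : Primrec Obs.outRight :=
  Primrec.of_eq (Primrec.snd.comp (Primrec.snd.comp (Primrec.snd.comp (Primrec.snd.comp primrec_counts)))) fun _ => rfl

theorem primrec_others : Primrec Obs.others :=
  Primrec.of_eq (Primrec.nat_add.comp (Primrec.nat_add.comp (Primrec.nat_add.comp (Primrec.nat_add.comp
    (Primrec.fst.comp primrec_counts) primrec_inLeft) primrec_inRight) primrec_outLeft)
    primrec_outRight) fun _ => rfl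

theorem primrec_pow_two {f : α → ℕ} (hf : Primrec f) : Primrec fun a => 2 ^ f a :=
  (Primrec₂.unpaired'.1 Nat.Primrec.pow).comp (Primrec.const 2) hf

theorem primrec_mul_const (c : ℕ) {f : α → ℕ} (hf : Primrec f) : Primrec fun a => c * f a :=
  Primrec.nat_mul.comp (Primrec.const c) hf

theorem primrecPred_nat_eq {f g : α → ℕ} (hf : Primrec f) (hg : Primrec g) :
    PrimrecPred fun a => f a = g a :=
  PrimrecRel.comp Primrec.eq hf hg

theorem primrec_ringSize (b : Bool) {f : α → ℕ} {g : α → Registers} (hf : Primrec f)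
    (hg : Primrec g) : Primrec fun a => (g a).ringSize b (f a) := by
  cases b
  · exact (primrec_size.comp hg).of_eq fun a => by simp [Registers.ringSize]
  · exact hf.of_eq fun a => by simp [Registers.ringSize]

theorem primrec_advance (b : Bool) {f : α → ℕ} {g : α → Registers} {h : α → Bool}
    (hf : Primrec f) (hg : Primrec g) (hh : Primrec h) :
    Primrec fun a => (g a).advance b (f a) (h a) := by
  have bit : Primrec fun a => (h a).toNat := (Primrec.dom_bool Bool.toNat).comp hh
  have moves : Primrec fun a => (g a).moves + 1 := Primrec.succ.comp (primrec_moves.comp hg)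
  have ones : Primrec fun a => (g a).ones + (h a).toNat :=
    Primrec.nat_add.comp (primrec_ones.comp hg) bit
  have size : Primrec fun a => if (g a).size = 0 ∧ (g a).ones + (h a).toNat = f a then
      (g a).moves + 1 else (g a).size :=
    Primrec.ite ((primrecPred_nat_eq (primrec_size.comp hg) (Primrec.const 0)).and
      (primrecPred_nat_eq ones hf)) moves (primrec_size.comp hg)
  have word : Primrec fun a => 2 * (g a).word + (h a).toNat :=
    Primrec.nat_add.comp (primrec_mul_const 2 (primrec_word.comp hg)) bit
  have N : Primrec fun a => if b = true then f a else
      if (g a).size = 0 ∧ (g a).ones + (h a).toNat = f a then (g a).moves + 1 else (g a).size := by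
    cases b
    · exact size.of_eq fun a => by simp
    · exact hf.of_eq fun a => by simp
  have key := Primrec.nat_mod.comp word (primrec_pow_two N)
  exact Primrec.ite
    ((PrimrecRel.comp Primrec.nat_lt N moves).and
      ((PrimrecRel.comp Primrec.nat_le moves (primrec_mul_const 2 N)).and
        (PrimrecRel.comp Primrec.nat_lt (primrec_best.comp hg) key)))
    (primrec_mk_registers moves ones size word key (Primrec.nat_add.comp moves N))
    (primrec_mk_registers moves ones size word (primrec_best.comp hg) (primrec_target.comp hg))

theorem primrecPred_arrived (b : Bool) {f : α → ℕ} {g : α → Registers} (hf : Primrec f)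
    (hg : Primrec g) : PrimrecPred fun a => (g a).Arrived b (f a) :=
  (primrecPred_nat_eq (primrec_moves.comp hg) (primrec_target.comp hg)).and
    (PrimrecRel.comp Primrec.nat_lt (primrec_mul_const 2 (primrec_ringSize b hf hg))
      (primrec_moves.comp hg))

theorem primrec_refresh (b : Bool) {f : α → ℕ} {g : α → Memory} {h : α → Obs} (hf : Primrec f)
    (hg : Primrec g) (hh : Primrec h) : Primrec fun a => (g a).refresh b (f a) (h a) := by
  have hR := primrec_regs.comp hg
  have hN := primrec_ringSize b hf hR
  exact Primrec.ite
    ((PrimrecRel.comp Primrec.eq (primrec_place.comp hh) (Primrec.const (Place.inb Side.right))).and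
      (PrimrecPred.not ((PrimrecPred.not (primrecPred_nat_eq hN (Primrec.const 0))).and
        (PrimrecRel.comp Primrec.nat_lt (primrec_mul_const 7 hN) (primrec_clock.comp hg)))))
    (primrec_advance b hf hR (primrec_homebase.comp hh)) hR

theorem primrecPred_meetsOpposite {p : α → Prop} {h : α → Obs} (hp : PrimrecPred p)
    (hh : Primrec h) : PrimrecPred fun a => MeetsOpposite (p a) (h a) :=
  (hp.and (PrimrecRel.comp Primrec.nat_lt (Primrec.const 0)
    (Primrec.nat_add.comp (primrec_inRight.comp hh) (primrec_outLeft.comp hh)))).or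
  (hp.not.and (PrimrecRel.comp Primrec.nat_lt (Primrec.const 0)
    (Primrec.nat_add.comp (primrec_inLeft.comp hh) (primrec_outRight.comp hh))))

theorem primrecPred_halts (b : Bool) {f t : α → ℕ} {g : α → Registers} {h : α → Obs}
    (hf : Primrec f) (ht : Primrec t) (hg : Primrec g) (hh : Primrec h) :
    PrimrecPred fun a => Halts b (f a) (t a) (g a) (h a) := by
  have hN := primrec_ringSize b hf hg
  exact ((PrimrecRel.comp Primrec.eq (Primrec.const b) (Primrec.const false)).and
      (primrecPred_nat_eq (Primrec.succ.comp (primrec_others.comp hh)) hf)).or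
    ((PrimrecPred.not (primrecPred_nat_eq hN (Primrec.const 0))).and
      ((PrimrecRel.comp Primrec.nat_le (primrec_mul_const 8 hN) ht).or
        ((PrimrecRel.comp Primrec.nat_lt (primrec_mul_const 7 hN) ht).and
          ((PrimrecRel.comp Primrec.eq (primrec_crossed.comp hh) (Primrec.const true)).or
            (primrecPred_meetsOpposite (primrecPred_arrived b hf hg) hh)))))

theorem primrec_direction (b : Bool) {f t : α → ℕ} {g : α → Registers}
    (hf : Primrec f) (ht : Primrec t) (hg : Primrec g) :
    Primrec fun a => direction b (f a) (t a) (g a) :=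
  Primrec.ite (primrecPred_arrived b hf hg)
    (Primrec.ite (PrimrecRel.comp Primrec.nat_le
      (primrec_mul_const 7 (primrec_ringSize b hf hg)) ht)
      (Primrec.const _) (Primrec.const _)) (Primrec.const _)

theorem primrec_gatherStep (b : Bool) :
    Primrec fun x : ℕ × Memory × Obs => gatherStep b x.1 x.2.1 x.2.2 := by
  have hm : Primrec fun x : ℕ × Memory × Obs => x.2.1 := Primrec.fst.comp Primrec.snd
  have ho : Primrec fun x : ℕ × Memory × Obs => x.2.2 := Primrec.snd.comp Primrec.snd
  have ht := primrec_clock.comp hm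
  have hR := primrec_refresh b Primrec.fst hm ho
  exact Primrec.ite (primrecPred_halts b Primrec.fst ht hR ho) (Primrec.const none)
    (Primrec.option_some.comp (Primrec.pair
      ((primrec_memory_symm.comp (Primrec.pair (Primrec.succ.comp ht) hR)).of_eq fun _ => rfl)
      (primrec_direction b Primrec.fst ht hR)))

end Computability

/-- The gathering protocol for agents that know the ring size (`b = true`) or the number of
agents (`b = false`). -/
@[reducible]
def gatherProtocol (b : Bool) : Protocol where
  Mem := Memory
  init := ⟨0, ⟨0, 0, 0, 0, 0, 0⟩⟩
  step := gatherStep b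
  computable_step := (primrec_gatherStep b).to_comp

theorem ofDigits_range_pos {r : ℕ} (hr : 0 < r) {f : ℕ → ℕ} (hf : 0 < f 0) :
    0 < Nat.ofDigits 2 ((List.range r).map f) := by
  obtain ⟨m, rfl⟩ := Nat.exists_eq_succ_of_ne_zero hr.ne'
  rw [List.range_succ_eq_map, List.map_cons, Nat.ofDigits_cons]
  exact Nat.add_pos_left hf _

namespace Config

variable {n k : ℕ} (C : Config n k)

/-- Whether a node is a homebase. -/
def bit (x : ZMod n) : Bool := decide (∃ a, C.home a = x)

theorem bit_eq_true {x : ZMod n} : C.bit x = true ↔ ∃ a, C.home a = x := decide_eq_true_iff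

theorem bit_home (a : Fin k) : C.bit (C.home a) = true := C.bit_eq_true.2 ⟨a, rfl⟩

theorem home_injective : Function.Injective C.home := fun _ _ h =>
  C.strictMono.injective (congrArg ZMod.val h)

/-- The index that follows `i` in clockwise order. -/
def next (i : Fin k) : Fin k := ⟨(i + 1) % k, Nat.mod_lt _ i.pos⟩

variable [NeZero n]

theorem home_add_gap (i : Fin k) : C.home i + (C.gap i : ZMod n) = C.home (next i) := by
  have hi := ZMod.val_lt (C.home i)
  have key : ((C.home i).val : ZMod n) = C.home i := ZMod.natCast_zmod_val _
  unfold gap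
  split_ifs with h
  · have hlt : (C.home i).val < (C.home ⟨i + 1, h⟩).val :=
      C.strictMono (show i < ⟨i + 1, h⟩ from Nat.lt_succ_self _)
    rw [Nat.cast_sub hlt.le, ZMod.natCast_zmod_val, ZMod.natCast_zmod_val, add_sub_cancel]
    congr 1
    exact Fin.ext (Nat.mod_eq_of_lt h).symm
  · rw [Nat.cast_sub (by omega), Nat.cast_add, ZMod.natCast_zmod_val, ZMod.natCast_zmod_val,
      ZMod.natCast_self, zero_add, add_sub_cancel]
    congr 1
    have : (i : ℕ) + 1 = k := by omega
    exact Fin.ext (by simp [next, this])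

theorem gap_pos (i : Fin k) : 0 < C.gap i := by
  have hi := ZMod.val_lt (C.home i)
  unfold gap
  split_ifs with h
  · exact Nat.sub_pos_of_lt (C.strictMono (show i < ⟨i + 1, h⟩ from Nat.lt_succ_self _))
  · omega

theorem home_add_ne (i a : Fin k) {g : ℕ} (hg : 0 < g) (hgi : g < C.gap i) :
    C.home a ≠ C.home i + (g : ZMod n) := by
  intro h
  have hi := ZMod.val_lt (C.home i)
  have h0 : (C.home ⟨0, i.pos⟩).val ≤ (C.home a).val :=
    C.strictMono.monotone (Fin.mk_le_of_le_val (Nat.zero_le _))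
  have h0i : (C.home ⟨0, i.pos⟩).val ≤ (C.home i).val :=
    C.strictMono.monotone (Fin.mk_le_of_le_val (Nat.zero_le _))
  have hv : (C.home a).val = ((C.home i).val + g) % n := by
    rw [h, ← ZMod.natCast_zmod_val (C.home i), ← Nat.cast_add, ZMod.val_natCast,
      ZMod.natCast_zmod_val]
  have lt_iff : ∀ {a b : Fin k}, (C.home a).val < (C.home b).val ↔ a < b := C.strictMono.lt_iff_lt
  unfold gap at hgi
  split_ifs at hgi with hk
  · have h1 := ZMod.val_lt (C.home ⟨i + 1, hk⟩)
    rw [Nat.mod_eq_of_lt (by omega)] at hv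
    have h2 : i < a := lt_iff.1 (by omega)
    have h3 : a < ⟨i + 1, hk⟩ := lt_iff.1 (by omega)
    rw [Fin.lt_def] at h2 h3
    simp only at h3
    omega
  · by_cases hlt : (C.home i).val + g < n
    · rw [Nat.mod_eq_of_lt hlt] at hv
      have h2 : i < a := lt_iff.1 (by omega)
      rw [Fin.lt_def] at h2
      omega
    · rw [Nat.mod_eq_sub_mod (by omega), Nat.mod_eq_of_lt (by omega)] at hv
      omega

section Translation

variable {C} {r : ZMod n} (hr : ∀ x, C.bit (x + r) = C.bit x)

include hr

theorem gap_eq_of_home_eq {i j : Fin k} (h : C.home j = C.home i + r) : C.gap i = C.gap j := by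
  rcases lt_trichotomy (C.gap i) (C.gap j) with hlt | heq | hlt
  · have : C.bit (C.home i + (C.gap i : ZMod n)) = true := by
      rw [home_add_gap]; exact C.bit_home _
    rw [← hr, add_right_comm, ← h] at this
    obtain ⟨a, ha⟩ := C.bit_eq_true.1 this
    exact absurd ha (C.home_add_ne j a (C.gap_pos i) hlt)
  · exact heq
  · have : C.bit (C.home j + (C.gap j : ZMod n)) = true := by
      rw [home_add_gap]; exact C.bit_home _
    rw [h, add_right_comm, hr] at this
    obtain ⟨a, ha⟩ := C.bit_eq_true.1 this
    exact absurd ha (C.home_add_ne i a (C.gap_pos j) hlt)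

theorem home_next_eq {i j : Fin k} (h : C.home j = C.home i + r) :
    C.home (next j) = C.home (next i) + r := by
  rw [← home_add_gap, ← home_add_gap, ← gap_eq_of_home_eq hr h, h, add_right_comm]

theorem isPeriodic_of_bit_add (hk : 0 < k) (h0 : r ≠ 0) : C.IsPeriodic := by
  set idx : ℕ → Fin k := fun i => ⟨i % k, Nat.mod_lt _ hk⟩ with hidx
  have idx_succ : ∀ i, idx (i + 1) = next (idx i) := fun i => Fin.ext (by simp [hidx, next])
  have idx_val : ∀ i : Fin k, idx i = i := fun i => Fin.ext (Nat.mod_eq_of_lt i.2)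
  obtain ⟨p, hp⟩ : ∃ p, C.home p = C.home (idx 0) + r :=
    C.bit_eq_true.1 (by rw [hr]; exact C.bit_home _)
  have shift : ∀ i : ℕ, C.home (idx (i + p)) = C.home (idx i) + r := by
    intro i
    induction i with
    | zero => rw [zero_add, idx_val, hp]
    | succ i ih => rw [add_right_comm, idx_succ, idx_succ]; exact home_next_eq hr ih
  have p_pos : 0 < (p : ℕ) := by
    rcases Nat.eq_zero_or_pos (p : ℕ) with h | h
    · refine absurd ?_ h0
      rw [← idx_val p, h] at hp
      exact left_eq_add.1 hp
    · exact h
  have gap_p : Function.Periodic (fun i => C.gap (idx i)) (p : ℕ) := fun i =>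
    (gap_eq_of_home_eq hr (shift i)).symm
  have gap_k : Function.Periodic (fun i => C.gap (idx i)) k := fun i => by simp [hidx]
  have hlt : Nat.gcd p k < k := (Nat.gcd_le_left _ p_pos).trans_lt p.2
  obtain ⟨m, hm⟩ : ∃ m, (p : ℕ) * m % k = Nat.gcd p k := by
    obtain ⟨m, -, hm⟩ := Nat.exists_mul_mod_eq_gcd (n := (p : ℕ)) (k := k) hlt
    exact ⟨m, hm⟩
  refine ⟨Nat.gcd p k, Nat.gcd_pos_of_pos_left _ p_pos, hlt, Nat.gcd_dvd_right _ _, fun i => ?_⟩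
  have e1 : C.gap (idx (i + p * m)) = C.gap (idx i) := by
    rw [mul_comm]; exact gap_p.nat_mul m i
  rw [idx_val] at e1
  rw [← e1]
  congr 1
  refine Fin.ext ?_
  simp only [hidx]
  rw [← hm, Nat.add_mod_mod]

end Translation

/-- The bits of the `n` nodes behind `x`, read as a binary number. -/
def windowValue (δ x : ZMod n) : ℕ :=
  Nat.ofDigits 2 ((List.range n).map fun l : ℕ => (C.bit (x - δ * (l : ZMod n))).toNat)

variable {C}

theorem windowValue_injective (hC : ¬ C.IsPeriodic) (hk : 0 < k) {δ : ZMod n} (hδ : δ * δ = 1) :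
    Function.Injective (C.windowValue δ) := by
  intro x y hxy
  have digits := Nat.ofDigits_inj_of_len_eq (by norm_num) (by simp) (by
      intro l hl
      obtain ⟨j, -, rfl⟩ := List.mem_map.1 hl
      exact Bool.toNat_lt _) (by
      intro l hl
      obtain ⟨j, -, rfl⟩ := List.mem_map.1 hl
      exact Bool.toNat_lt _) hxy
  have bits : ∀ z : ZMod n, C.bit (x - z) = C.bit (y - z) := by
    intro z
    have hz := List.map_inj_left.1 digits (δ * z).val (List.mem_range.2 (ZMod.val_lt _))
    rw [ZMod.natCast_zmod_val, ← mul_assoc, hδ, one_mul] at hz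
    revert hz
    cases C.bit (x - z) <;> cases C.bit (y - z) <;> simp
  by_contra hne
  refine hC (isPeriodic_of_bit_add (r := y - x) (fun z => ?_) hk (sub_ne_zero.2 (Ne.symm hne)))
  have := bits (x - z)
  rw [sub_sub_cancel] at this
  rw [this]
  congr 1
  ring

theorem windowValue_home_pos (δ : ZMod n) (a : Fin k) : 0 < C.windowValue δ (C.home a) := by
  unfold windowValue
  refine ofDigits_range_pos (NeZero.pos n) ?_
  rw [Nat.cast_zero, mul_zero, sub_zero, C.bit_home]
  exact Nat.one_pos

/-- Without periodicity, the windows single out one node. -/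
theorem exists_elected (hC : ¬ C.IsPeriodic) (hk : 0 < k) {δ : ZMod n} (hδ : δ * δ = 1) :
    ∃ v : ZMod n, 0 < C.windowValue δ v ∧ ∀ x ≠ v, C.windowValue δ x < C.windowValue δ v := by
  obtain ⟨v, hv⟩ := Finite.exists_max (C.windowValue δ)
  exact ⟨v, (windowValue_home_pos δ ⟨0, hk⟩).trans_le (hv _), fun x hx =>
    (hv x).lt_of_ne fun h => hx (windowValue_injective hC hk hδ h)⟩

end Config

namespace Registers

/-- The registers after `m` steps to nodes with the bits `x 1, …, x m`. -/
def afterMoves (b : Bool) (κ : ℕ) (x : ℕ → Bool) : ℕ → Registers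
  | 0 => ⟨0, 0, 0, 0, 0, 0⟩
  | m + 1 => (afterMoves b κ x m).advance b κ (x (m + 1))

section

variable (b : Bool) (κ : ℕ) (x : ℕ → Bool)

theorem advance_moves (R : Registers) (y : Bool) :
    (R.advance b κ y).moves = R.moves + 1 := by
  unfold advance; dsimp only; split_ifs <;> rfl

theorem advance_ones (R : Registers) (y : Bool) :
    (R.advance b κ y).ones = R.ones + y.toNat := by
  unfold advance; dsimp only; split_ifs <;> rfl

theorem advance_size (R : Registers) (y : Bool) :
    (R.advance b κ y).size =
      if R.size = 0 ∧ R.ones + y.toNat = κ then R.moves + 1 else R.size := by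
  unfold advance; dsimp only; split_ifs <;> rfl

theorem advance_word (R : Registers) (y : Bool) :
    (R.advance b κ y).word = 2 * R.word + y.toNat := by
  unfold advance; dsimp only; split_ifs <;> rfl

/-- The condition under which a step updates the best window. -/
def Improves (R : Registers) (y : Bool) : Prop :=
  (R.advance b κ y).ringSize b κ < R.moves + 1 ∧
    R.moves + 1 ≤ 2 * (R.advance b κ y).ringSize b κ ∧
    R.best < (R.advance b κ y).word % 2 ^ (R.advance b κ y).ringSize b κ

theorem advance_of_improves {R : Registers} {y : Bool} (h : R.Improves b κ y) :
    (R.advance b κ y).best = (R.advance b κ y).word % 2 ^ (R.advance b κ y).ringSize b κ ∧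
      (R.advance b κ y).target = R.moves + 1 + (R.advance b κ y).ringSize b κ := by
  unfold Improves ringSize at h
  unfold ringSize
  rw [advance_size, advance_word] at *
  unfold advance
  dsimp only
  rw [if_pos h]
  exact ⟨rfl, rfl⟩

theorem advance_of_not_improves {R : Registers} {y : Bool} (h : ¬ R.Improves b κ y) :
    (R.advance b κ y).best = R.best ∧ (R.advance b κ y).target = R.target := by
  unfold Improves ringSize at h
  rw [advance_size, advance_word] at h
  unfold advance
  dsimp only
  rw [if_neg h]
  exact ⟨rfl, rfl⟩

theorem afterMoves_moves (m : ℕ) : (afterMoves b κ x m).moves = m := by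
  induction m with
  | zero => rfl
  | succ m ih => rw [afterMoves, advance_moves, ih]

theorem afterMoves_ones (m : ℕ) :
    (afterMoves b κ x m).ones = ∑ j ∈ Finset.range m, (x (j + 1)).toNat := by
  induction m with
  | zero => rfl
  | succ m ih => rw [afterMoves, advance_ones, ih, Finset.sum_range_succ]

theorem afterMoves_word_mod (m : ℕ) : ∀ r ≤ m, (afterMoves b κ x m).word % 2 ^ r =
    Nat.ofDigits 2 ((List.range r).map fun l => (x (m - l)).toNat) := by
  induction m with
  | zero =>
    intro r hr
    obtain rfl : r = 0 := by omega
    simp [Nat.mod_one]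
  | succ m ih =>
    intro r hr
    cases r with
    | zero => simp [Nat.mod_one]
    | succ r =>
      have hx := Bool.toNat_lt (x (m + 1))
      have key := ih r (by omega)
      rw [afterMoves, advance_word, List.range_succ_eq_map, List.map_cons, Nat.ofDigits_cons,
        List.map_map]
      have e : ((fun l => (x (m + 1 - l)).toNat) ∘ Nat.succ) = fun l => (x (m - l)).toNat := by
        funext l
        simp only [Function.comp_apply]
        congr 2
        omega
      rw [e, ← key, pow_succ', Nat.sub_zero, Nat.mod_mul, add_comm (2 * _) (Bool.toNat _),
        Nat.add_mul_mod_self_left, Nat.mod_eq_of_lt hx, Nat.add_mul_div_left _ _ two_pos,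
        Nat.div_eq_of_lt hx, zero_add]

end

section Spec

variable {b : Bool} {κ n k : ℕ} {x : ℕ → Bool}

theorem afterMoves_ringSize_of_known (hb : b = true) (hκ : κ = n) (m : ℕ) :
    (afterMoves b κ x m).ringSize b κ = n := by
  simp [ringSize, hb, hκ]

theorem afterMoves_ringSize_of_unknown (hn : 0 < n) (hb : b = false) (hκ : κ = k)
    (hx : x n = true) (hsum : ∑ j ∈ Finset.range n, (x (j + 1)).toNat = k) (m : ℕ) :
    (afterMoves b κ x m).ringSize b κ = if m < n then 0 else n := by
  subst hb hκ
  have hsize : ∀ R : Registers, R.ringSize false κ = R.size := fun R => by simp [ringSize]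
  rw [hsize]
  induction m with
  | zero => simp [hn, afterMoves]
  | succ m ih =>
    rw [afterMoves, advance_size, afterMoves_moves, ih, afterMoves_ones,
      ← Finset.sum_range_succ (fun j => (x (j + 1)).toNat)]
    rcases lt_trichotomy (m + 1) n with h | h | h
    · have hlt : ∑ j ∈ Finset.range (m + 1), (x (j + 1)).toNat < κ := by
        obtain ⟨l, rfl⟩ : ∃ l, n = l + 1 := ⟨n - 1, by omega⟩
        rw [← hsum, Finset.sum_range_succ _ l, hx]
        refine Nat.lt_succ_of_le (Finset.sum_le_sum_of_subset ?_)
        exact Finset.range_subset_range.2 (by omega)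
      rw [if_pos (by omega : m < n), if_neg (fun hc => hlt.ne hc.2), if_pos h]
    · rw [if_pos (by omega : m < n), h, if_pos ⟨rfl, hsum⟩, if_neg (lt_irrefl _)]
    · rw [if_neg (by omega : ¬ m < n), if_neg (fun hc => hn.ne' hc.1), if_neg (by omega)]

/-- If one window among those that end at `n + 1, …, 2 * n` is the largest, then its end plus `n`
becomes the target. -/
theorem afterMoves_arrived_iff
    (hN : ∀ m, (afterMoves b κ x m).ringSize b κ = n ∨
      m < n ∧ (afterMoves b κ x m).ringSize b κ = 0)
    {top : ℕ} (h1 : n < top) (h2 : top ≤ 2 * n)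
    (hpos : 0 < (afterMoves b κ x top).word % 2 ^ n)
    (hmax : ∀ m, n < m → m ≤ 2 * n → m ≠ top →
      (afterMoves b κ x m).word % 2 ^ n < (afterMoves b κ x top).word % 2 ^ n)
    (m : ℕ) : (afterMoves b κ x m).Arrived b κ ↔ m = top + n := by
  have hN' : ∀ m, n ≤ m → (afterMoves b κ x m).ringSize b κ = n := fun m hm =>
    (hN m).resolve_right fun h => by omega
  have imp : ∀ m, (afterMoves b κ x m).Improves b κ (x (m + 1)) ↔ n < m + 1 ∧ m + 1 ≤ 2 * n ∧
      (afterMoves b κ x m).best < (afterMoves b κ x (m + 1)).word % 2 ^ n := by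
    intro m
    unfold Improves
    rw [← afterMoves, afterMoves_moves]
    rcases hN (m + 1) with h | ⟨h, h0⟩
    · rw [h]
    · rw [h0]; constructor <;> intro hc <;> omega
  have low : ∀ m ≤ n, (afterMoves b κ x m).best = 0 ∧ (afterMoves b κ x m).target = 0 := by
    intro m
    induction m with
    | zero => intro _; exact ⟨rfl, rfl⟩
    | succ m ih =>
      intro hm
      have hni : ¬ (afterMoves b κ x m).Improves b κ (x (m + 1)) := by rw [imp]; omega
      have := advance_of_not_improves b κ hni
      rw [afterMoves, this.1, this.2]
      exact ih (by omega)
  have mid : ∀ m < top, (afterMoves b κ x m).best < (afterMoves b κ x top).word % 2 ^ n := by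
    intro m
    induction m with
    | zero => intro _; exact hpos
    | succ m ih =>
      intro hm
      by_cases hi : (afterMoves b κ x m).Improves b κ (x (m + 1))
      · have h := (imp m).1 hi
        rw [afterMoves, (advance_of_improves b κ hi).1, ← afterMoves, hN' _ (by omega)]
        exact hmax _ (by omega) (by omega) (by omega)
      · rw [afterMoves, (advance_of_not_improves b κ hi).1]
        exact ih (by omega)
  have high : ∀ m, top ≤ m → (afterMoves b κ x m).best = (afterMoves b κ x top).word % 2 ^ n ∧
      (afterMoves b κ x m).target = top + n := by
    refine Nat.le_induction ?_ fun m hm ih => ?_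
    · obtain ⟨m, rfl⟩ : ∃ m, top = m + 1 := ⟨top - 1, by omega⟩
      have hi := (imp m).2 ⟨h1, h2, mid m (by omega)⟩
      have := advance_of_improves b κ hi
      rw [afterMoves_moves, ← afterMoves, hN' _ (by omega)] at this
      exact this
    · have hni : ¬ (afterMoves b κ x m).Improves b κ (x (m + 1)) := by
        rw [imp, ih.1]
        intro hc
        exact lt_asymm hc.2.2 (hmax _ hc.1 hc.2.1 (by omega))
      have := advance_of_not_improves b κ hni
      rw [afterMoves, this.1, this.2]
      exact ih
  unfold Arrived
  rw [afterMoves_moves]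
  constructor
  · rintro ⟨ht, hs⟩
    by_cases hm : m ≤ n
    · rw [(low m hm).2] at ht; omega
    · rw [hN' m (by omega)] at hs
      rw [(high m (by omega)).2] at ht
      exact ht
  · rintro rfl
    rw [(high (top + n) (by omega)).2, hN' _ (by omega)]
    omega

end Spec

end Registers

section Walk

theorem natCast_zmod_inj {n c x y : ℕ} (h : (x : ZMod n) = y) (hx : c ≤ x) (hx' : x < c + n)
    (hy : c ≤ y) (hy' : y < c + n) : x = y := by
  rw [ZMod.natCast_eq_natCast_iff] at h
  rcases le_total x y with hle | hle
  · have := Nat.eq_zero_of_dvd_of_lt ((Nat.modEq_iff_dvd' hle).1 h) (by omega)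
    omega
  · have := Nat.eq_zero_of_dvd_of_lt ((Nat.modEq_iff_dvd' hle).1 h.symm) (by omega)
    omega

variable {n k : ℕ} [NeZero n] (C : Config n k)

theorem Config.sum_bit_eq (δ : ZMod n) (hδ : δ * δ = 1) (h : ZMod n) :
    ∑ j ∈ Finset.range n, (C.bit (h + δ * ((j + 1 : ℕ) : ZMod n))).toNat = k := by
  have e1 : ∑ j ∈ Finset.range n, (C.bit (h + δ * ((j + 1 : ℕ) : ZMod n))).toNat =
      ∑ y : ZMod n, (C.bit y).toNat := by
    refine Finset.sum_bij (fun j _ => h + δ * ((j + 1 : ℕ) : ZMod n)) (fun _ _ => Finset.mem_univ _)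
      (fun i hi j hj hij => ?_) (fun y _ => ?_) (fun _ _ => rfl)
    · have := congrArg (δ * ·) (add_left_cancel hij)
      simp only [← mul_assoc, hδ, one_mul, Nat.cast_add, Nat.cast_one] at this
      have := (ZMod.natCast_eq_natCast_iff' _ _ _).1 (add_right_cancel this)
      rwa [Nat.mod_eq_of_lt (Finset.mem_range.1 hi), Nat.mod_eq_of_lt (Finset.mem_range.1 hj)] at this
    · refine ⟨(δ * (y - h) - 1).val, Finset.mem_range.2 (ZMod.val_lt _), ?_⟩
      rw [Nat.cast_add, ZMod.natCast_zmod_val, Nat.cast_one, sub_add_cancel, ← mul_assoc, hδ]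
      ring
  have e2 : ∀ y : ZMod n, (C.bit y).toNat = if y ∈ Finset.univ.image C.home then 1 else 0 := by
    intro y
    have : C.bit y = true ↔ y ∈ Finset.univ.image C.home := by
      rw [C.bit_eq_true]; simp
    by_cases hy : C.bit y = true
    · rw [if_pos (this.1 hy), hy]; rfl
    · rw [if_neg (fun hc => hy (this.2 hc)), Bool.eq_false_of_not_eq_true hy]; rfl
  rw [e1, Finset.sum_congr rfl fun y _ => e2 y, Finset.sum_boole]
  simp [Finset.card_image_of_injective _ C.home_injective]

/-- The registers of an agent with homebase `h` that has made `m` moves in the direction `δ`. -/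
def Config.walkRegs (b : Bool) (κ : ℕ) (δ h : ZMod n) (m : ℕ) : Registers :=
  Registers.afterMoves b κ (fun j => C.bit (h + δ * (j : ZMod n))) m

variable {C} {b : Bool} {κ : ℕ} {δ : ZMod n}

theorem Config.walkRegs_ringSize (hb : b = true → κ = n) (hb' : b = false → κ = k)
    (hδ : δ * δ = 1) (a : Fin k) (m : ℕ) :
    (C.walkRegs b κ δ (C.home a) m).ringSize b κ = if b = false ∧ m < n then 0 else n := by
  cases hbb : b
  · subst hbb
    rw [walkRegs, Registers.afterMoves_ringSize_of_unknown (NeZero.pos n) rfl (hb' rfl)]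
    · simp
    · rw [ZMod.natCast_self, mul_zero, add_zero, C.bit_home]
    · exact C.sum_bit_eq δ hδ _
  · subst hbb
    rw [walkRegs, Registers.afterMoves_ringSize_of_known rfl (hb rfl)]
    simp

theorem Config.exists_targets (hb : b = true → κ = n) (hb' : b = false → κ = k)
    (hδ : δ * δ = 1) (hC : ¬ C.IsPeriodic) (hk : 0 < k) :
    ∃ (v : ZMod n) (D : Fin k → ℕ), ∀ a, 2 * n < D a ∧ D a ≤ 3 * n ∧
      C.home a + δ * (D a : ZMod n) = v ∧
      ∀ m, (C.walkRegs b κ δ (C.home a) m).Arrived b κ ↔ m = D a := by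
  obtain ⟨v, v_pos, v_max⟩ := C.exists_elected hC hk hδ
  refine ⟨v, ?_⟩
  refine Classical.axiomOfChoice (r := fun a (D : ℕ) => 2 * n < D ∧ D ≤ 3 * n ∧
      C.home a + δ * (D : ZMod n) = v ∧
      ∀ m, (C.walkRegs b κ δ (C.home a) m).Arrived b κ ↔ m = D) fun a => ?_
  have hw : ∀ m, n < m → (C.walkRegs b κ δ (C.home a) m).word % 2 ^ n =
      C.windowValue δ (C.home a + δ * (m : ZMod n)) := by
    intro m hm
    rw [walkRegs, Registers.afterMoves_word_mod _ _ _ _ _ hm.le, windowValue]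
    congr 1
    refine List.map_congr_left fun l hl => ?_
    have := List.mem_range.1 hl
    rw [Nat.cast_sub (by omega)]
    congr 2
    ring
  set e := (δ * (v - C.home a) - 1).val with he
  have hlt : e < n := ZMod.val_lt _
  have hcast : (e : ZMod n) = δ * (v - C.home a) - 1 := ZMod.natCast_zmod_val _
  have hv : C.home a + δ * ((e + 1 + n : ℕ) : ZMod n) = v := by
    rw [Nat.cast_add, Nat.cast_add, hcast, ZMod.natCast_self, Nat.cast_one, add_zero,
      sub_add_cancel, ← mul_assoc, hδ]
    ring
  refine ⟨e + 1 + n + n, by omega, by omega, ?_, fun m => ?_⟩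
  · rw [Nat.cast_add, ZMod.natCast_self, add_zero, hv]
  · refine Registers.afterMoves_arrived_iff (fun m => ?_) (by omega) (by omega) ?_ ?_ m
    · have := C.walkRegs_ringSize hb hb' hδ a m
      rw [walkRegs] at this
      rw [this]
      split_ifs with h
      · exact Or.inr ⟨h.2, rfl⟩
      · exact Or.inl rfl
    · have := hw (e + 1 + n) (by omega)
      rw [walkRegs] at this
      rw [this, hv]
      exact v_pos
    · intro m h1 h2 h3
      have e1 := hw m h1
      have e2 := hw (e + 1 + n) (by omega)
      rw [walkRegs] at e1 e2
      rw [e1, e2, hv]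
      refine v_max _ fun hc => h3 ?_
      have := add_left_cancel (hc.trans hv.symm)
      have := congrArg (δ * ·) this
      simp only [← mul_assoc, hδ, one_mul] at this
      exact natCast_zmod_inj (c := n + 1) this (by omega) (by omega) (by omega) (by omega)

end Walk

/-- The displacement caused by a move through a port. -/
def Port.dir {n : ℕ} : Port → ZMod n
  | .minus => -1
  | .plus => 1

theorem Port.dir_mul_dir {n : ℕ} (p : Port) : (p.dir : ZMod n) * p.dir = 1 := by
  cases p <;> simp [Port.dir]

theorem Port.dir_opp {n : ℕ} (p : Port) : (p.opp.dir : ZMod n) = -p.dir := by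
  cases p <;> simp [Port.dir, Port.opp]

theorem Port.opp_opp (p : Port) : p.opp.opp = p := by cases p <;> rfl

theorem Port.opp_ne (p : Port) : p.opp ≠ p := by cases p <;> simp [Port.opp]

theorem neighbour_eq {n : ℕ} (v : ZMod n) (p : Port) : neighbour v p = v + p.dir := by
  cases p <;> simp [Port.dir, neighbour, sub_eq_add_neg]

theorem edgeAt_inj {n : ℕ} {v w : ZMod n} {p : Port} : edgeAt v p = edgeAt w p ↔ v = w := by
  cases p <;> simp [edgeAt]

theorem edgeAt_eq_edgeAt_opp {n : ℕ} {v w : ZMod n} {p : Port} :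
    edgeAt v p = edgeAt w p.opp ↔ w = v + p.dir := by
  cases p
  · simp only [edgeAt, Port.opp, Port.dir, ← sub_eq_add_neg]; exact eq_comm
  · simp only [edgeAt, Port.opp, Port.dir]; rw [eq_sub_iff_add_eq]; exact eq_comm

theorem exists_add_dir_mul {n : ℕ} [NeZero n] (p : Port) (v w : ZMod n) :
    ∃ d < n, w = v + p.dir * (d : ZMod n) :=
  ⟨(p.dir * (w - v)).val, ZMod.val_lt _, by
    rw [ZMod.natCast_zmod_val, ← mul_assoc, p.dir_mul_dir]; ring⟩

theorem dir_mul_natCast_eq_zero {n : ℕ} {p : Port} {g : ℕ} (h : (p.dir : ZMod n) * (g : ZMod n) = 0) :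
    n ∣ g := by
  have := congrArg (p.dir * ·) h
  simp only [← mul_assoc, p.dir_mul_dir, one_mul, mul_zero] at this
  exact (ZMod.natCast_eq_zero_iff _ _).1 this

section Walk

variable {n k : ℕ} (h : Fin k → ZMod n) (p : Port) (D : Fin k → ℕ) (missing : Schedule n)

/-- The number of moves made until round `t`, when agent `i` starts in `h i` and tries to leave
through the port `p` until it has made `D i` moves. -/
def walkMoves : ℕ → Fin k → ℕ
  | 0, _ => 0
  | t + 1, i =>
    if walkMoves t i < D i ∧
        missing t ≠ some (edgeAt (h i + p.dir * (walkMoves t i : ZMod n)) p) then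
      walkMoves t i + 1
    else walkMoves t i

/-- The position reached by agent `i` until round `t`. -/
def walkPos (t : ℕ) (i : Fin k) : ZMod n := h i + p.dir * (walkMoves h p D missing t i : ZMod n)

variable {h p D missing}

theorem walkMoves_succ (t : ℕ) (i : Fin k) : walkMoves h p D missing (t + 1) i =
    if walkMoves h p D missing t i < D i ∧
      missing t ≠ some (edgeAt (walkPos h p D missing t i) p) then
      walkMoves h p D missing t i + 1 else walkMoves h p D missing t i := rfl

theorem walkMoves_le (t : ℕ) (i : Fin k) : walkMoves h p D missing t i ≤ D i := by
  induction t with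
  | zero => exact Nat.zero_le _
  | succ t ih => rw [walkMoves_succ]; split_ifs <;> omega

theorem walkMoves_le_succ (t : ℕ) (i : Fin k) :
    walkMoves h p D missing t i ≤ walkMoves h p D missing (t + 1) i := by
  rw [walkMoves_succ]; split_ifs <;> omega

theorem walkPos_succ_eq {t : ℕ} {i j : Fin k} (hi : walkMoves h p D missing t i < D i)
    (hj : walkMoves h p D missing t j < D j)
    (hij : walkPos h p D missing t i = walkPos h p D missing t j) :
    walkPos h p D missing (t + 1) i = walkPos h p D missing (t + 1) j := by
  have hij' := hij
  unfold walkPos at hij'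
  unfold walkPos
  rw [walkMoves_succ, walkMoves_succ, hij]
  by_cases hm : missing t = some (edgeAt (walkPos h p D missing t j) p)
  · rw [if_neg (fun hc => hc.2 hm), if_neg (fun hc => hc.2 hm), hij']
  · rw [if_pos ⟨hi, hm⟩, if_pos ⟨hj, hm⟩, Nat.cast_succ, Nat.cast_succ, mul_add, mul_add,
      ← add_assoc, ← add_assoc, hij']

/-- Two walkers that have not met were never blocked in the same round. -/
theorem le_walkMoves_add {i j : Fin k} (t : ℕ) (hi : walkMoves h p D missing t i < D i)
    (hj : walkMoves h p D missing t j < D j)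
    (hij : walkPos h p D missing t i ≠ walkPos h p D missing t j) :
    t ≤ walkMoves h p D missing t i + walkMoves h p D missing t j := by
  induction t with
  | zero => exact Nat.zero_le _
  | succ t ih =>
    have hi' := (walkMoves_le_succ t i).trans_lt hi
    have hj' := (walkMoves_le_succ t j).trans_lt hj
    have hne : walkPos h p D missing t i ≠ walkPos h p D missing t j := fun hc =>
      hij (walkPos_succ_eq hi' hj' hc)
    have := ih hi' hj' hne
    rw [walkMoves_succ, walkMoves_succ]
    by_cases hm : missing t = some (edgeAt (walkPos h p D missing t i) p)
    · have : missing t ≠ some (edgeAt (walkPos h p D missing t j) p) := fun hc =>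
        hne (edgeAt_inj.1 (Option.some.inj (hm.symm.trans hc)))
      rw [if_pos (c := walkMoves h p D missing t j < D j ∧ _) ⟨hj', this⟩]
      split_ifs <;> omega
    · rw [if_pos ⟨hi', hm⟩]
      split_ifs <;> omega

theorem walkMoves_le_add {i j : Fin k} (hD : n ≤ D i) {d : ℕ} (hd : h i = h j + p.dir * (d : ZMod n))
    (t : ℕ) (hi : walkMoves h p D missing t i < n) :
    walkMoves h p D missing t j ≤ d + walkMoves h p D missing t i := by
  induction t with
  | zero => exact Nat.zero_le _
  | succ t ih =>
    have hi' := (walkMoves_le_succ t i).trans_lt hi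
    have ih := ih hi'
    rcases ih.lt_or_eq with hlt | heq
    · have := walkMoves_le_succ (h := h) (p := p) (D := D) (missing := missing) t i
      rw [walkMoves_succ t j]
      split_ifs <;> omega
    · have hpos : walkPos h p D missing t i = walkPos h p D missing t j := by
        unfold walkPos
        rw [heq, hd]; push_cast; ring
      rw [walkMoves_succ, walkMoves_succ, hpos]
      by_cases hm : missing t = some (edgeAt (walkPos h p D missing t j) p)
      · rw [if_neg (fun hc => hc.2 hm), if_neg (fun hc => hc.2 hm)]; exact ih
      · rw [if_pos (c := walkMoves h p D missing t i < D i ∧ _) ⟨by omega, hm⟩]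
        split_ifs <;> omega

variable (hD : ∀ i, 2 * n < D i ∧ D i ≤ 3 * n)

include hD

theorem walkPos_eq_of_lt {i j : Fin k} (hi : walkMoves h p D missing (7 * n) i < D i)
    (hj : walkMoves h p D missing (7 * n) j < D j) :
    walkPos h p D missing (7 * n) i = walkPos h p D missing (7 * n) j := by
  by_contra hij
  have := le_walkMoves_add _ hi hj hij
  have := hD i
  have := hD j
  omega

theorem walkPos_eq_of_moves_lt [NeZero n] {i : Fin k}
    (hi : walkMoves h p D missing (7 * n) i < n) (j : Fin k) :
    walkPos h p D missing (7 * n) j = walkPos h p D missing (7 * n) i := by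
  obtain ⟨d, hd, he⟩ := exists_add_dir_mul p (h j) (h i)
  have hDi := hD i
  have hDj := hD j
  have := walkMoves_le_add (j := j) (by omega) he _ hi
  exact walkPos_eq_of_lt hD (by omega) (by omega)

end Walk

section Round

variable {n k : ℕ} {b : Bool} {κ : ℕ} {C : Config n k} {lam : Orientations k}
  {w : Fin k → Agent n Memory} {i : Fin k} {e : Option (ZMod n)}

/-- At the beginning of round `t` nobody has terminated, and agent `i` is going to have the
registers `R i`. -/
def Ready (b : Bool) (κ : ℕ) (C : Config n k) (lam : Orientations k) (t : ℕ)
    (R : Fin k → Registers) (w : Fin k → Agent n Memory) : Prop :=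
  ∀ i, ∃ M, (w i).mem = some M ∧ M.clock = t ∧ M.refresh b κ (observe C lam w i) = R i

theorem Ready.decision_eq {t : ℕ} {R : Fin k → Registers} (hw : Ready b κ C lam t R w)
    (i : Fin k) : decision (gatherProtocol b) κ C lam w i =
      if Halts b κ t (R i) (observe C lam w i) then none
      else some (⟨t + 1, R i⟩, direction b κ t (R i)) := by
  obtain ⟨M, hM, rfl, hR⟩ := hw i
  simp only [decision, hM, Option.bind_some, gatherStep, hR]

theorem Ready.decision_eq_none {t : ℕ} {R : Fin k → Registers} (hw : Ready b κ C lam t R w)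
    (i : Fin k) : decision (gatherProtocol b) κ C lam w i = none ↔
      Halts b κ t (R i) (observe C lam w i) := by
  rw [hw.decision_eq]
  split_ifs with h <;> simp [h]

theorem Ready.decision_of_ne_none {t : ℕ} {R : Fin k → Registers} (hw : Ready b κ C lam t R w)
    (h : decision (gatherProtocol b) κ C lam w i ≠ none) :
    decision (gatherProtocol b) κ C lam w i = some (⟨t + 1, R i⟩, direction b κ t (R i)) := by
  rw [hw.decision_eq, if_neg (fun hc => h ((hw.decision_eq_none i).2 hc))]

theorem intent_eq {m : Memory} {d : Option Side}
    (h : decision (gatherProtocol b) κ C lam w i = some (m, d)) :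
    intent (gatherProtocol b) κ C lam w i = d.map (lam i).symm := by
  simp [intent, h]

theorem nextRound_of_nil {m : Memory}
    (h : decision (gatherProtocol b) κ C lam w i = some (m, none)) :
    nextRound (gatherProtocol b) κ C lam e w i = ⟨some m, (w i).pos, .node, false⟩ := by
  simp only [nextRound, intent_eq h, h]
  rfl

theorem nextRound_of_blocked {m : Memory} {s : Side}
    (h : decision (gatherProtocol b) κ C lam w i = some (m, some s))
    (he : e = some (edgeAt (w i).pos ((lam i).symm s))) :
    nextRound (gatherProtocol b) κ C lam e w i =
      ⟨some m, (w i).pos, .outb ((lam i).symm s), false⟩ := by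
  simp only [nextRound, intent_eq h, h, Option.map_some, if_pos he]

theorem nextRound_of_free {m : Memory} {s : Side}
    (h : decision (gatherProtocol b) κ C lam w i = some (m, some s))
    (he : e ≠ some (edgeAt (w i).pos ((lam i).symm s))) :
    nextRound (gatherProtocol b) κ C lam e w i =
      ⟨some m, (w i).pos + ((lam i).symm s).dir, .inb ((lam i).symm s).opp,
        decide (∃ j, intent (gatherProtocol b) κ C lam w j = some ((lam i).symm s).opp ∧
          edgeAt (w j).pos ((lam i).symm s).opp = edgeAt (w i).pos ((lam i).symm s))⟩ := by
  simp only [nextRound, intent_eq h, h, Option.map_some, if_neg he, neighbour_eq]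

theorem nextRound_of_halt (h : decision (gatherProtocol b) κ C lam w i = none) :
    nextRound (gatherProtocol b) κ C lam e w i = ⟨none, (w i).pos, .node, false⟩ := by
  simp [nextRound, intent, h]

theorem nextRound_mem :
    (nextRound (gatherProtocol b) κ C lam e w i).mem =
      (decision (gatherProtocol b) κ C lam w i).map Prod.fst := by
  unfold nextRound
  dsimp only
  split
  · rfl
  · split_ifs <;> rfl

theorem decision_of_mem_none (h : (w i).mem = none) :
    decision (gatherProtocol b) κ C lam w i = none := by
  simp [decision, h]

theorem observe_others (w : Fin k → Agent n Memory) (i : Fin k) :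
    (observe C lam w i).others =
      (Finset.univ.filter fun j => j ≠ i ∧ (w j).pos = (w i).pos).card := by
  have key : ∀ q : Place Side, countOthers lam w i q =
      ((Finset.univ.filter fun j => j ≠ i ∧ (w j).pos = (w i).pos).filter
        fun j => (w j).place.map (lam i) = q).card := by
    intro q
    rw [Finset.filter_filter]
    simp only [countOthers, and_assoc]
  rw [Finset.card_eq_sum_card_fiberwise (f := fun j => (w j).place.map (lam i))
    (t := {.node, .inb .left, .inb .right, .outb .left, .outb .right})]
  · simp [Obs.others, observe, key]
    ring
  · intro j _
    have : ∀ q : Place Side, q ∈ ({.node, .inb .left, .inb .right, .outb .left, .outb .right} :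
        Finset (Place Side)) := by
      rintro (_ | (_ | _) | (_ | _)) <;> simp
    exact this _

theorem others_add_one_eq_iff (w : Fin k → Agent n Memory) (i : Fin k) :
    (observe C lam w i).others + 1 = k ↔ ∀ j, (w j).pos = (w i).pos := by
  have hcard : (Finset.univ.erase i).card + 1 = k := by
    rw [Finset.card_erase_add_one (Finset.mem_univ i), Finset.card_univ, Fintype.card_fin]
  have hsub : (Finset.univ.filter fun j => j ≠ i ∧ (w j).pos = (w i).pos) ⊆
      Finset.univ.erase i := fun j hj => by
    simp only [Finset.mem_filter] at hj
    exact Finset.mem_erase.2 ⟨hj.2.1, Finset.mem_univ _⟩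
  rw [observe_others]
  constructor
  · intro h j
    by_cases hj : j = i
    · rw [hj]
    · have := (Finset.eq_of_subset_of_card_le hsub (by omega)).ge
        (Finset.mem_erase.2 ⟨hj, Finset.mem_univ j⟩)
      exact (Finset.mem_filter.1 this).2.2
  · intro h
    refine Eq.trans ?_ hcard
    congr 2
    ext j
    simp [h j]

theorem gathered_of_forall_eq {v : ZMod n} (h : ∀ i, (w i).pos = v) : Gathered w :=
  ⟨v, fun i => Or.inl (h i)⟩

theorem gathered_of_adjacent {u v : ZMod n} (p : Port) (huv : v = u + p.dir)
    (h : ∀ i, (w i).pos = u ∨ (w i).pos = v) : Gathered w := by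
  cases p
  · refine ⟨v, fun i => (h i).symm.imp id fun hi => ?_⟩
    rw [hi, huv, Port.dir, neg_add_cancel_right]
  · exact ⟨u, fun i => (h i).imp id fun hi => hi.trans huv⟩

/-- All agents terminate in this round, and they are gathered. -/
def Finishes (b : Bool) (κ : ℕ) (C : Config n k) (lam : Orientations k)
    (w : Fin k → Agent n Memory) : Prop :=
  (∀ i, decision (gatherProtocol b) κ C lam w i = none) ∧ Gathered w

theorem Ready.finishes_of_count {t : ℕ} {R : Fin k → Registers} (hw : Ready b κ C lam t R w)
    (hb : b = false) (hκ : κ = k) (h : (observe C lam w i).others + 1 = k) :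
    Finishes b κ C lam w := by
  rw [others_add_one_eq_iff] at h
  refine ⟨fun j => (hw.decision_eq_none j).2 (Or.inl ⟨hb, ?_⟩), gathered_of_forall_eq h⟩
  rw [hκ, others_add_one_eq_iff]
  exact fun l => (h l).trans (h j).symm

end Round

theorem Memory.refresh_of_ne {b : Bool} {κ : ℕ} {m : Memory} {o : Obs}
    (h : o.place ≠ .inb .right) : m.refresh b κ o = m.regs := if_neg fun hc => h hc.1

theorem Memory.refresh_of_late {b : Bool} {κ : ℕ} {m : Memory} {o : Obs}
    (h0 : m.regs.ringSize b κ ≠ 0) (h : 7 * m.regs.ringSize b κ < m.clock) :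
    m.refresh b κ o = m.regs := if_neg fun hc => hc.2 ⟨h0, h⟩

theorem Memory.refresh_of_early {b : Bool} {κ : ℕ} {m : Memory} {o : Obs}
    (h : o.place = .inb .right)
    (h0 : m.regs.ringSize b κ ≠ 0 → m.clock ≤ 7 * m.regs.ringSize b κ) :
    m.refresh b κ o = m.regs.advance b κ o.homebase :=
  if_pos ⟨h, fun hc => (h0 hc.1).not_gt hc.2⟩

/-- Nobody terminates before round `t`. -/
def NoHalt {n k : ℕ} (b : Bool) (κ : ℕ) (C : Config n k) (lam : Orientations k)
    (missing : Schedule n) (t : ℕ) : Prop :=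
  ∀ s < t, ∀ i, decision (gatherProtocol b) κ C lam
    (run (gatherProtocol b) κ C lam missing s) i ≠ none

theorem symm_right {μ : Port ≃ Side} {p : Port} (hp : μ.symm .left = p) :
    μ.symm .right = p.opp := by
  have h : μ.symm .right ≠ p := fun hc => by
    have := μ.symm.injective (hp.trans hc.symm)
    cases this
  generalize μ.symm .right = q at *
  cases p <;> cases q <;> simp_all [Port.opp]

theorem map_left {μ : Port ≃ Side} {p : Port} (hp : μ.symm .left = p) : μ p = .left := by
  rw [← hp, Equiv.apply_symm_apply]

theorem map_right {μ : Port ≃ Side} {p : Port} (hp : μ.symm .left = p) : μ p.opp = .right := by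
  rw [← symm_right hp, Equiv.apply_symm_apply]

theorem Place.map_injective {P Q : Type} {f : P → Q} (hf : Function.Injective f) :
    Function.Injective (Place.map f) := by
  rintro (_ | _ | _) (_ | _ | _) h <;> simp_all [Place.map, hf.eq_iff]

theorem countOthers_pos_iff {n k : ℕ} {lam : Orientations k} {w : Fin k → Agent n Memory}
    {i : Fin k} {q : Place Port} :
    0 < countOthers lam w i (q.map (lam i)) ↔
      ∃ j ≠ i, (w j).pos = (w i).pos ∧ (w j).place = q := by
  simp [countOthers, Finset.card_pos, Finset.Nonempty,
    (Place.map_injective (lam i).injective).eq_iff]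

section FirstPhase

variable {n k : ℕ} [NeZero n] {b : Bool} {κ : ℕ} {C : Config n k} {lam : Orientations k}
  {missing : Schedule n} {p : Port} {D : Fin k → ℕ}
  (hp : ∀ i, (lam i).symm .left = p)
  (hb : b = true → κ = n) (hb' : b = false → κ = k)
  (hD : ∀ i, 2 * n < D i)
  (hA : ∀ i m, (C.walkRegs b κ p.dir (C.home i) m).Arrived b κ ↔ m = D i)

include hp hb hb' hD hA

/-- In the first phase the agents walk to their targets. -/
theorem firstPhase (t : ℕ) (ht : t ≤ 7 * n) (hh : NoHalt b κ C lam missing t) :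
    Ready b κ C lam t
        (fun i => C.walkRegs b κ p.dir (C.home i) (walkMoves C.home p D missing t i))
        (run (gatherProtocol b) κ C lam missing t) ∧
      ∀ i, (run (gatherProtocol b) κ C lam missing t i).pos =
        walkPos C.home p D missing t i := by
  induction t with
  | zero =>
    constructor
    · intro i
      refine ⟨_, rfl, rfl, ?_⟩
      rw [Memory.refresh_of_ne]
      · rfl
      · simp [observe, run, Place.map]
    · intro i
      simp [run, walkPos, walkMoves]
  | succ t ih =>
    obtain ⟨hw, hpos⟩ := ih (by omega) fun s hs => hh s (by omega)
    have main : ∀ i, ∃ M, (run (gatherProtocol b) κ C lam missing (t + 1) i).mem = some M ∧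
        M.clock = t + 1 ∧
        M.refresh b κ (observe C lam (run (gatherProtocol b) κ C lam missing (t + 1)) i) =
          C.walkRegs b κ p.dir (C.home i) (walkMoves C.home p D missing (t + 1) i) ∧
        (run (gatherProtocol b) κ C lam missing (t + 1) i).pos =
          walkPos C.home p D missing (t + 1) i := by
      intro i
      have hdec := hw.decision_of_ne_none (hh t (by omega) i)
      set w := run (gatherProtocol b) κ C lam missing t
      have hrun : run (gatherProtocol b) κ C lam missing (t + 1) =
        nextRound (gatherProtocol b) κ C lam (missing t) w := rfl
      rw [hrun]
      set m := walkMoves C.home p D missing t i with hm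
      have hN := C.walkRegs_ringSize hb hb' p.dir_mul_dir i m
      have hstep := walkMoves_succ (h := C.home) (p := p) (D := D) (missing := missing) t i
      rw [← hm, ← hpos i] at hstep
      unfold walkPos
      have hpos' : (w i).pos = C.home i + p.dir * (m : ZMod n) := hpos i
      by_cases harr : m = D i
      · have hdir : direction b κ t (C.walkRegs b κ p.dir (C.home i) m) = none := by
          have h2 := hD i
          rw [if_neg (fun hc => by omega)] at hN
          rw [direction, if_pos ((hA i m).2 harr), hN, if_neg (by omega)]
        rw [hdir] at hdec
        rw [if_neg (by omega)] at hstep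
        have hnext := nextRound_of_nil (e := missing t) hdec
        refine ⟨_, congrArg Agent.mem hnext, rfl, ?_, ?_⟩
        · rw [Memory.refresh_of_ne, hstep]
          simp [observe, hnext, Place.map]
        · rw [hnext, hstep]; exact hpos'
      · have hlt : m < D i := lt_of_le_of_ne (walkMoves_le t i) harr
        have hdir : direction b κ t (C.walkRegs b κ p.dir (C.home i) m) = some .left := by
          rw [direction, if_neg fun hc => harr ((hA i m).1 hc)]
        rw [hdir] at hdec
        by_cases he : missing t = some (edgeAt (w i).pos p)
        · rw [if_neg (fun hc => hc.2 he)] at hstep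
          have hnext := nextRound_of_blocked (e := missing t) hdec (by rw [hp]; exact he)
          refine ⟨_, congrArg Agent.mem hnext, rfl, ?_, ?_⟩
          · rw [Memory.refresh_of_ne, hstep]
            simp [observe, hnext, Place.map]
          · rw [hnext, hstep]; exact hpos'
        · rw [if_pos ⟨hlt, he⟩] at hstep
          have hnext := nextRound_of_free (e := missing t) hdec (by rw [hp]; exact he)
          have hposn : (nextRound (gatherProtocol b) κ C lam (missing t) w i).pos =
              C.home i + p.dir * ((m + 1 : ℕ) : ZMod n) := by
            rw [hnext, hp i]
            show (w i).pos + p.dir = _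
            rw [hpos', Nat.cast_succ, mul_add, mul_one, add_assoc]
          refine ⟨_, congrArg Agent.mem hnext, rfl, ?_, ?_⟩
          · rw [Memory.refresh_of_early, hstep]
            · show Registers.advance _ _ _ (C.bit _) = _
              rw [hposn]
              rfl
            · simp [observe, hnext, Place.map, hp i, map_right (hp i)]
            · show Registers.ringSize b κ (C.walkRegs b κ p.dir (C.home i) m) ≠ 0 →
                t + 1 ≤ 7 * Registers.ringSize b κ (C.walkRegs b κ p.dir (C.home i) m)
              rw [hN]
              split_ifs <;> omega
          · rw [hposn, hstep]
    choose M h1 h2 h3 h4 using main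
    exact ⟨fun i => ⟨M i, h1 i, h2 i, h3 i⟩, h4⟩

/-- If somebody terminates in the first phase, then because all agents are in the same node. -/
theorem firstPhase_finishes (t : ℕ) (ht : t ≤ 7 * n) (hh : NoHalt b κ C lam missing t) {i : Fin k}
    (hi : decision (gatherProtocol b) κ C lam
      (run (gatherProtocol b) κ C lam missing t) i = none) :
    Finishes b κ C lam (run (gatherProtocol b) κ C lam missing t) := by
  obtain ⟨hw, -⟩ := firstPhase hp hb hb' hD hA t ht hh
  have hn := NeZero.pos n
  rcases (hw.decision_eq_none i).1 hi with ⟨h1, h2⟩ | ⟨h1, h2⟩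
  · exact hw.finishes_of_count h1 (hb' h1) (h2.trans (hb' h1))
  · rw [C.walkRegs_ringSize hb hb' p.dir_mul_dir] at h1 h2
    split_ifs at h1 h2 with h
    · exact absurd rfl h1
    · rcases h2 with h2 | h2 <;> omega

/-- Whoever enters the second phase knows the ring size. -/
theorem ringSize_of_noHalt (hD' : ∀ i, D i ≤ 3 * n)
    (hh : NoHalt b κ C lam missing (7 * n + 1)) (i : Fin k) :
    (C.walkRegs b κ p.dir (C.home i)
      (walkMoves C.home p D missing (7 * n) i)).ringSize b κ = n := by
  rw [C.walkRegs_ringSize hb hb' p.dir_mul_dir]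
  refine if_neg fun ⟨h1, h2⟩ => ?_
  obtain ⟨hw, hpos⟩ := firstPhase hp hb hb' hD hA (7 * n) le_rfl fun s hs => hh s (by omega)
  refine hh (7 * n) (by omega) i ((hw.decision_eq_none i).2 (Or.inl ⟨h1,
    ((others_add_one_eq_iff _ _).2 fun j => ?_).trans (hb' h1).symm⟩))
  rw [hpos, hpos]
  exact walkPos_eq_of_moves_lt (fun i => ⟨hD i, hD' i⟩) h2 j

end FirstPhase

section SecondPhase

variable {n k : ℕ} {b : Bool} {κ : ℕ} {C : Config n k} {lam : Orientations k}
  {p : Port} {R : Fin k → Registers} {w : Fin k → Agent n Memory} {t : ℕ} {u v : ZMod n}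

/-- The agents that have arrived are at `v`, the other ones at `u`. -/
structure Split (b : Bool) (κ : ℕ) (C : Config n k) (lam : Orientations k) (t : ℕ)
    (R : Fin k → Registers) (u v : ZMod n) (w : Fin k → Agent n Memory) : Prop where
  ready : Ready b κ C lam t R w
  pos_of_arrived : ∀ i, (R i).Arrived b κ → (w i).pos = v
  pos_of_not_arrived : ∀ i, ¬ (R i).Arrived b κ → (w i).pos = u

/-- The places show in which direction the agents go: through `p`, or through the opposite port
if they have arrived. -/
structure Facing (b : Bool) (κ : ℕ) (p : Port) (R : Fin k → Registers)
    (w : Fin k → Agent n Memory) : Prop where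
  place_of_arrived : ∀ i, (R i).Arrived b κ → (w i).place = .inb p ∨ (w i).place = .outb p.opp
  place_of_not_arrived : ∀ i, ¬ (R i).Arrived b κ →
    (w i).place = .inb p.opp ∨ (w i).place = .outb p

theorem Split.meetsOpposite_iff (hp : ∀ i, (lam i).symm .left = p)
    (hw : Split b κ C lam t R u v w) (hf : Facing b κ p R w) (i : Fin k) :
    MeetsOpposite ((R i).Arrived b κ) (observe C lam w i) ↔
      u = v ∧ ∃ j, ¬ ((R j).Arrived b κ ↔ (R i).Arrived b κ) := by
  have inr : (observe C lam w i).inRight = countOthers lam w i ((Place.inb p.opp).map (lam i)) := by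
    rw [Place.map, map_right (hp i)]; rfl
  have inl : (observe C lam w i).inLeft = countOthers lam w i ((Place.inb p).map (lam i)) := by
    rw [Place.map, map_left (hp i)]; rfl
  have outr : (observe C lam w i).outRight =
      countOthers lam w i ((Place.outb p.opp).map (lam i)) := by
    rw [Place.map, map_right (hp i)]; rfl
  have outl : (observe C lam w i).outLeft = countOthers lam w i ((Place.outb p).map (lam i)) := by
    rw [Place.map, map_left (hp i)]; rfl
  rw [MeetsOpposite, inr, inl, outr, outl, Nat.add_pos_iff_pos_or_pos, Nat.add_pos_iff_pos_or_pos,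
    countOthers_pos_iff, countOthers_pos_iff, countOthers_pos_iff, countOthers_pos_iff]
  by_cases hi : (R i).Arrived b κ
  · have hpi := hw.pos_of_arrived i hi
    simp only [hi, true_and, not_true_eq_false, false_and, or_false, iff_true]
    constructor
    · rintro (⟨j, -, h1, h2⟩ | ⟨j, -, h1, h2⟩) <;>
      · have hj : ¬ (R j).Arrived b κ := fun hj => by
          rcases hf.place_of_arrived j hj with h | h <;> rw [h] at h2 <;> clear * - h2 <;>
            cases p <;> simp [Port.opp] at h2
        exact ⟨(hw.pos_of_not_arrived j hj).symm.trans (h1.trans hpi), j, hj⟩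
    · rintro ⟨huv, j, hj⟩
      have hji : j ≠ i := fun hc => hj (hc ▸ hi)
      have hpos := (hw.pos_of_not_arrived j hj).trans (huv.trans hpi.symm)
      exact (hf.place_of_not_arrived j hj).imp (fun h => ⟨j, hji, hpos, h⟩)
        fun h => ⟨j, hji, hpos, h⟩
  · have hpi := hw.pos_of_not_arrived i hi
    simp only [hi, true_and, not_false_eq_true, false_and, false_or, iff_false, not_not]
    constructor
    · rintro (⟨j, -, h1, h2⟩ | ⟨j, -, h1, h2⟩) <;>
      · have hj : (R j).Arrived b κ := by
          by_contra hj
          rcases hf.place_of_not_arrived j hj with h | h <;> rw [h] at h2 <;> clear * - h2 <;>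
            cases p <;> simp [Port.opp] at h2
        exact ⟨(hpi.symm.trans h1.symm).trans (hw.pos_of_arrived j hj), j, hj⟩
    · rintro ⟨huv, j, hj⟩
      have hji : j ≠ i := fun hc => hi (hc ▸ hj)
      have hpos := (hw.pos_of_arrived j hj).trans (huv.symm.trans hpi.symm)
      exact (hf.place_of_arrived j hj).imp (fun h => ⟨j, hji, hpos, h⟩)
        fun h => ⟨j, hji, hpos, h⟩

/-- One round of the second phase. -/
theorem Split.next [NeZero n] (hp : ∀ i, (lam i).symm .left = p) (hN : ∀ i, (R i).ringSize b κ = n)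
    (ht : 7 * n ≤ t) (hw : Split b κ C lam t R u v w)
    (hh : ∀ i, decision (gatherProtocol b) κ C lam w i ≠ none) (e : Option (ZMod n)) :
    Split b κ C lam (t + 1) R (if e = some (edgeAt u p) then u else u + p.dir)
        (if e = some (edgeAt v p.opp) then v else v - p.dir)
        (nextRound (gatherProtocol b) κ C lam e w) ∧
      Facing b κ p R (nextRound (gatherProtocol b) κ C lam e w) ∧
      ∀ i, (nextRound (gatherProtocol b) κ C lam e w i).crossed = true ↔
        e ≠ some (edgeAt u p) ∧ v = u + p.dir ∧
          ∃ j, ¬ ((R j).Arrived b κ ↔ (R i).Arrived b κ) := by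
  have hdec : ∀ i, decision (gatherProtocol b) κ C lam w i = some (⟨t + 1, R i⟩,
      some (if (R i).Arrived b κ then .right else .left)) := by
    intro i
    rw [hw.ready.decision_of_ne_none (hh i), direction, hN, if_pos ht]
    split_ifs <;> rfl
  have hint : ∀ i, intent (gatherProtocol b) κ C lam w i =
      some (if (R i).Arrived b κ then p.opp else p) := by
    intro i
    rw [intent_eq (hdec i), Option.map_some]
    split_ifs
    · rw [symm_right (hp i)]
    · rw [hp i]
  have hready : Ready b κ C lam (t + 1) R (nextRound (gatherProtocol b) κ C lam e w) := by
    intro i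
    refine ⟨⟨t + 1, R i⟩, ?_, rfl, ?_⟩
    · rw [nextRound_mem, hdec i]; rfl
    · have := NeZero.ne n
      rw [Memory.refresh_of_late] <;> dsimp only <;> rw [hN] <;> omega
  have harr : ∀ i, (R i).Arrived b κ →
      (nextRound (gatherProtocol b) κ C lam e w i).pos =
        (if e = some (edgeAt v p.opp) then v else v - p.dir) ∧
      ((nextRound (gatherProtocol b) κ C lam e w i).place = .inb p ∨
        (nextRound (gatherProtocol b) κ C lam e w i).place = .outb p.opp) ∧
      ((nextRound (gatherProtocol b) κ C lam e w i).crossed = true ↔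
        e ≠ some (edgeAt u p) ∧ v = u + p.dir ∧
          ∃ j, ¬ ((R j).Arrived b κ ↔ (R i).Arrived b κ)) := by
    intro i hi
    have hpi := hw.pos_of_arrived i hi
    have hd := hdec i
    rw [if_pos hi] at hd
    have hs := symm_right (hp i)
    by_cases he : e = some (edgeAt v p.opp)
    · rw [nextRound_of_blocked hd (by rw [hs, hpi]; exact he), if_pos he]
      refine ⟨hpi, Or.inr (by rw [hs]), ?_⟩
      simp only [Bool.false_eq_true, false_iff]
      rintro ⟨h1, h2, -⟩
      exact h1 (by rw [he, edgeAt_eq_edgeAt_opp.2 h2])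
    · rw [nextRound_of_free hd (by rw [hs, hpi]; exact he), if_neg he]
      refine ⟨by rw [hs, hpi, Port.dir_opp, sub_eq_add_neg], Or.inl (by rw [hs, Port.opp_opp]), ?_⟩
      simp only [decide_eq_true_eq, hs, Port.opp_opp, hint, hpi, hi, iff_true]
      constructor
      · rintro ⟨j, h1, h2⟩
        have hj : ¬ (R j).Arrived b κ := fun hj => by
          rw [if_pos hj] at h1
          exact p.opp_ne (Option.some.inj h1)
        rw [hw.pos_of_not_arrived j hj] at h2
        exact ⟨by rw [h2]; exact he, edgeAt_eq_edgeAt_opp.1 h2, j, hj⟩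
      · rintro ⟨-, h2, j, hj⟩
        exact ⟨j, by rw [if_neg hj], by
          rw [hw.pos_of_not_arrived j hj]; exact edgeAt_eq_edgeAt_opp.2 h2⟩
  have hnot : ∀ i, ¬ (R i).Arrived b κ →
      (nextRound (gatherProtocol b) κ C lam e w i).pos =
        (if e = some (edgeAt u p) then u else u + p.dir) ∧
      ((nextRound (gatherProtocol b) κ C lam e w i).place = .inb p.opp ∨
        (nextRound (gatherProtocol b) κ C lam e w i).place = .outb p) ∧
      ((nextRound (gatherProtocol b) κ C lam e w i).crossed = true ↔
        e ≠ some (edgeAt u p) ∧ v = u + p.dir ∧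
          ∃ j, ¬ ((R j).Arrived b κ ↔ (R i).Arrived b κ)) := by
    intro i hi
    have hpi := hw.pos_of_not_arrived i hi
    have hd := hdec i
    rw [if_neg hi] at hd
    by_cases he : e = some (edgeAt u p)
    · rw [nextRound_of_blocked hd (by rw [hp, hpi]; exact he), if_pos he]
      refine ⟨hpi, Or.inr (by rw [hp]), ?_⟩
      simp only [Bool.false_eq_true, false_iff]
      exact fun h => h.1 he
    · rw [nextRound_of_free hd (by rw [hp, hpi]; exact he), if_neg he]
      refine ⟨by rw [hp, hpi], Or.inl (by rw [hp]), ?_⟩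
      simp only [decide_eq_true_eq, hp, hint, hpi, hi, iff_false, not_not]
      constructor
      · rintro ⟨j, h1, h2⟩
        have hj : (R j).Arrived b κ := by
          by_contra hj
          rw [if_neg hj] at h1
          exact p.opp_ne (Option.some.inj h1).symm
        rw [hw.pos_of_arrived j hj] at h2
        exact ⟨he, edgeAt_eq_edgeAt_opp.1 h2.symm, j, hj⟩
      · rintro ⟨-, h2, j, hj⟩
        exact ⟨j, by rw [if_pos hj], by
          rw [hw.pos_of_arrived j hj]; exact (edgeAt_eq_edgeAt_opp.2 h2).symm⟩
  refine ⟨⟨hready, fun i hi => (harr i hi).1, fun i hi => (hnot i hi).1⟩,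
    ⟨fun i hi => (harr i hi).2.1, fun i hi => (hnot i hi).2.1⟩, fun i => ?_⟩
  by_cases hi : (R i).Arrived b κ
  · exact (harr i hi).2.2
  · exact (hnot i hi).2.2

end SecondPhase

section Approach

variable {n k : ℕ} {b : Bool} {κ : ℕ} {C : Config n k} {lam : Orientations k}
  {p : Port} {R : Fin k → Registers} {w : Fin k → Agent n Memory} {s t : ℕ}

/-- The situation after `s` rounds of the second phase: the two groups, if there are two, are at a
distance that has decreased by `s` at least, unless they are adjacent. -/
def Approach (b : Bool) (κ : ℕ) (C : Config n k) (lam : Orientations k) (p : Port)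
    (R : Fin k → Registers) (s : ℕ) (w : Fin k → Agent n Memory) : Prop :=
  ∃ u v, Split b κ C lam (7 * n + s) R u v w ∧
    (1 ≤ s → Facing b κ p R w ∧ ∀ i, (w i).crossed ≠ true) ∧
    ∀ i j, ¬ ((R j).Arrived b κ ↔ (R i).Arrived b κ) →
      ∃ g : ℕ, v = u + p.dir * (g : ZMod n) ∧ 1 ≤ g ∧ g ≤ max 1 (n - s)

theorem Split.pos_eq_of_iff {u v : ZMod n} (hw : Split b κ C lam t R u v w)
    {i j : Fin k} (h : (R j).Arrived b κ ↔ (R i).Arrived b κ) : (w j).pos = (w i).pos := by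
  by_cases hi : (R i).Arrived b κ
  · rw [hw.pos_of_arrived i hi, hw.pos_of_arrived j (h.2 hi)]
  · rw [hw.pos_of_not_arrived i hi, hw.pos_of_not_arrived j fun hj => hi (h.1 hj)]

theorem Split.pos_eq_or {u v : ZMod n} (hw : Split b κ C lam t R u v w) (i : Fin k) :
    (w i).pos = u ∨ (w i).pos = v := by
  by_cases hi : (R i).Arrived b κ
  · exact Or.inr (hw.pos_of_arrived i hi)
  · exact Or.inl (hw.pos_of_not_arrived i hi)

variable [NeZero n] (hN : ∀ i, (R i).ringSize b κ = n)

include hN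

theorem Ready.decision_none_of_signal (hw : Ready b κ C lam t R w) (ht : 7 * n < t) {i : Fin k}
    (h : (w i).crossed = true ∨ MeetsOpposite ((R i).Arrived b κ) (observe C lam w i)) :
    decision (gatherProtocol b) κ C lam w i = none := by
  rw [hw.decision_eq_none, Halts, hN]
  exact Or.inr ⟨NeZero.ne n, Or.inr ⟨ht, h⟩⟩

theorem Approach.finishes (hw : Approach b κ C lam p R n w) : Finishes b κ C lam w := by
  obtain ⟨u, v, hs, -, hg⟩ := hw
  refine ⟨fun i => ?_, ?_⟩
  · rw [hs.ready.decision_eq_none, Halts, hN]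
    exact Or.inr ⟨NeZero.ne n, Or.inl (by omega)⟩
  · by_cases hmix : ∃ i j, ¬ ((R j).Arrived b κ ↔ (R i).Arrived b κ)
    · obtain ⟨i, j, hij⟩ := hmix
      obtain ⟨g, hv, h1, h2⟩ := hg i j hij
      obtain rfl : g = 1 := by rw [Nat.sub_self] at h2; omega
      rw [Nat.cast_one, mul_one] at hv
      exact gathered_of_adjacent p hv hs.pos_eq_or
    · push Not at hmix
      rcases isEmpty_or_nonempty (Fin k) with he | ⟨⟨i⟩⟩
      · exact ⟨0, fun i => he.elim i⟩
      · exact gathered_of_forall_eq fun j => hs.pos_eq_of_iff (hmix i j)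

theorem Approach.finishes_of_halt (hp : ∀ i, (lam i).symm .left = p) (hb' : b = false → κ = k)
    (hn : 2 ≤ n) (h1 : 1 ≤ s) (hsn : s ≤ n) (hw : Approach b κ C lam p R s w) {i : Fin k}
    (hi : decision (gatherProtocol b) κ C lam w i = none) : Finishes b κ C lam w := by
  by_cases hs : s = n
  · subst hs; exact hw.finishes hN
  obtain ⟨u, v, hsplit, hface, hg⟩ := hw
  rw [hsplit.ready.decision_eq_none, Halts, hN] at hi
  rcases hi with ⟨hbf, hc⟩ | ⟨-, hlate | ⟨-, hcross | hmeet⟩⟩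
  · exact hsplit.ready.finishes_of_count hbf (hb' hbf) (hc.trans (hb' hbf))
  · omega
  · exact absurd hcross ((hface h1).2 i)
  · obtain ⟨huv, j, hj⟩ := (hsplit.meetsOpposite_iff hp (hface h1).1 i).1 hmeet
    obtain ⟨g, hv, hg1, hg2⟩ := hg i j hj
    rw [huv, left_eq_add] at hv
    have := Nat.le_of_dvd (by omega) (dir_mul_natCast_eq_zero hv)
    omega

theorem Approach.next (hp : ∀ i, (lam i).symm .left = p) (hw : Approach b κ C lam p R s w)
    (hh : ∀ i, decision (gatherProtocol b) κ C lam w i ≠ none) (e : Option (ZMod n)) :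
    Finishes b κ C lam (nextRound (gatherProtocol b) κ C lam e w) ∨
      Approach b κ C lam p R (s + 1) (nextRound (gatherProtocol b) κ C lam e w) := by
  obtain ⟨u, v, hsplit, -, hg⟩ := hw
  obtain ⟨hs, hf, hc⟩ := hsplit.next hp hN (by omega) hh e
  set w' := nextRound (gatherProtocol b) κ C lam e w
  by_cases hmix : ∃ i j, ¬ ((R j).Arrived b κ ↔ (R i).Arrived b κ)
  swap
  · refine Or.inr ⟨_, _, hs, fun _ => ⟨hf, fun i hi => ?_⟩, fun i j hij => absurd ⟨i, j, hij⟩ hmix⟩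
    obtain ⟨-, -, j, hj⟩ := (hc i).1 hi
    exact hmix ⟨i, j, hj⟩
  obtain ⟨i, j, hij⟩ := hmix
  have other : ∀ l, ∃ j, ¬ ((R j).Arrived b κ ↔ (R l).Arrived b κ) := by
    intro l
    by_cases hl : (R j).Arrived b κ ↔ (R l).Arrived b κ
    · exact ⟨i, fun h => hij (hl.trans h.symm)⟩
    · exact ⟨j, hl⟩
  obtain ⟨g, hv, h1, h2⟩ := hg i j hij
  by_cases hg1 : g = 1
  · subst hg1
    rw [Nat.cast_one, mul_one] at hv
    have hedge : edgeAt v p.opp = edgeAt u p := (edgeAt_eq_edgeAt_opp.2 hv).symm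
    rw [hedge] at hs
    by_cases he : e = some (edgeAt u p)
    · rw [if_pos he, if_pos he] at hs
      exact Or.inr ⟨u, v, hs, fun _ => ⟨hf, fun l hl => ((hc l).1 hl).1 he⟩, fun _ _ _ =>
        ⟨1, by rw [Nat.cast_one, mul_one, hv], le_rfl, le_max_left _ _⟩⟩
    · rw [if_neg he, if_neg he] at hs
      refine Or.inl ⟨fun l => hs.ready.decision_none_of_signal hN (by omega)
        (Or.inl ((hc l).2 ⟨he, hv, other l⟩)), ?_⟩
      refine gathered_of_adjacent p (u := v - p.dir) (v := u + p.dir) ?_ fun l => (hs.pos_eq_or l).symm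
      rw [hv, add_sub_cancel_right]
  · have hne : v ≠ u + p.dir := by
      intro h
      have h0 : (p.dir : ZMod n) * ((g - 1 : ℕ) : ZMod n) = 0 := by
        rw [Nat.cast_sub h1, Nat.cast_one, mul_sub, mul_one, sub_eq_zero]
        exact add_left_cancel (hv.symm.trans h)
      have := Nat.le_of_dvd (by omega) (dir_mul_natCast_eq_zero h0)
      omega
    have hcross : ∀ l, (w' l).crossed ≠ true := fun l hl => hne ((hc l).1 hl).2.1
    have hcast1 : ((g - 1 : ℕ) : ZMod n) = g - 1 := by rw [Nat.cast_sub h1, Nat.cast_one]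
    by_cases he : e = some (edgeAt u p)
    · have he' : e ≠ some (edgeAt v p.opp) := fun h =>
        hne (edgeAt_eq_edgeAt_opp.1 (Option.some.inj (he.symm.trans h)))
      rw [if_pos he, if_neg he'] at hs
      refine Or.inr ⟨_, _, hs, fun _ => ⟨hf, hcross⟩, fun _ _ _ =>
        ⟨g - 1, by rw [hcast1, hv]; ring, by omega, by omega⟩⟩
    · rw [if_neg he] at hs
      by_cases he' : e = some (edgeAt v p.opp)
      · rw [if_pos he'] at hs
        refine Or.inr ⟨_, _, hs, fun _ => ⟨hf, hcross⟩, fun _ _ _ =>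
          ⟨g - 1, by rw [hcast1, hv]; ring, by omega, by omega⟩⟩
      · rw [if_neg he'] at hs
        have hcast2 : ((g - 2 : ℕ) : ZMod n) = g - 2 := by rw [Nat.cast_sub (by omega)]; rfl
        have hv' : v - p.dir = u + p.dir + p.dir * ((g - 2 : ℕ) : ZMod n) := by
          rw [hcast2, hv]; ring
        by_cases hg2 : g = 2
        · rw [hg2, Nat.sub_self, Nat.cast_zero, mul_zero, add_zero] at hv'
          refine Or.inl ⟨fun l => hs.ready.decision_none_of_signal hN (by omega)
            (Or.inr ((hs.meetsOpposite_iff hp hf l).2 ⟨hv'.symm, other l⟩)),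
            gathered_of_forall_eq (v := v - p.dir) fun l => ?_⟩
          exact (hs.pos_eq_or l).elim (fun h => h.trans hv'.symm) id
        · exact Or.inr ⟨_, _, hs, fun _ => ⟨hf, hcross⟩, fun _ _ _ =>
            ⟨g - 2, hv', by omega, by omega⟩⟩

end Approach

section Execution

variable {n k : ℕ} {b : Bool} {κ : ℕ} {C : Config n k} {lam : Orientations k}
  {missing : Schedule n}

theorem noHalt_succ {t : ℕ} (hh : NoHalt b κ C lam missing t)
    (h : ∀ i, decision (gatherProtocol b) κ C lam
      (run (gatherProtocol b) κ C lam missing t) i = none →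
      Finishes b κ C lam (run (gatherProtocol b) κ C lam missing t))
    (hf : ¬ Finishes b κ C lam (run (gatherProtocol b) κ C lam missing t)) :
    NoHalt b κ C lam missing (t + 1) := by
  intro s hs i hi
  rcases Nat.lt_succ_iff_lt_or_eq.1 hs with hlt | rfl
  · exact hh s hlt i hi
  · exact hf (h i hi)

theorem exists_finishes [NeZero n] (hn : 2 ≤ n) (hk : 0 < k) (hC : ¬ C.IsPeriodic) (hlam : Chirality lam)
    (hb : b = true → κ = n) (hb' : b = false → κ = k) :
    ∃ t ≤ 8 * n, NoHalt b κ C lam missing t ∧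
      Finishes b κ C lam (run (gatherProtocol b) κ C lam missing t) := by
  obtain ⟨p, hp⟩ : ∃ p, ∀ i, (lam i).symm .left = p :=
    ⟨(lam ⟨0, hk⟩).symm .left, fun i => by rw [hlam i ⟨0, hk⟩]⟩
  obtain ⟨v, D, hD⟩ := C.exists_targets hb hb' p.dir_mul_dir hC hk
  have hD1 : ∀ i, 2 * n < D i := fun i => (hD i).1
  have hD2 : ∀ i, D i ≤ 3 * n := fun i => (hD i).2.1
  have hA := fun i => (hD i).2.2.2
  by_contra hno
  push Not at hno
  have first : ∀ t ≤ 7 * n + 1, NoHalt b κ C lam missing t := by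
    intro t
    induction t with
    | zero => exact fun _ s hs => absurd hs (Nat.not_lt_zero s)
    | succ t ih =>
      intro ht
      have hh := ih (by omega)
      exact noHalt_succ hh (fun i hi =>
        firstPhase_finishes hp hb hb' hD1 hA t (by omega) hh hi) (hno t (by omega) hh)
  obtain ⟨hready, hpos⟩ := firstPhase hp hb hb' hD1 hA (7 * n) le_rfl (first _ (by omega))
  set R := fun i => C.walkRegs b κ p.dir (C.home i) (walkMoves C.home p D missing (7 * n) i)
  have hN : ∀ i, (R i).ringSize b κ = n :=
    ringSize_of_noHalt hp hb hb' hD1 hA hD2 (first _ le_rfl)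
  have start : Approach b κ C lam p R 0 (run (gatherProtocol b) κ C lam missing (7 * n)) := by
    obtain ⟨u, hu⟩ : ∃ u, ∀ i, ¬ (R i).Arrived b κ →
        (run (gatherProtocol b) κ C lam missing (7 * n) i).pos = u := by
      by_cases h : ∃ i, ¬ (R i).Arrived b κ
      · obtain ⟨i, hi⟩ := h
        refine ⟨walkPos C.home p D missing (7 * n) i, fun j hj => ?_⟩
        rw [hpos]
        exact walkPos_eq_of_lt (fun i => ⟨hD1 i, hD2 i⟩)
          ((walkMoves_le _ _).lt_of_ne fun h => hj ((hA _ _).2 h))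
          ((walkMoves_le _ _).lt_of_ne fun h => hi ((hA _ _).2 h))
      · push Not at h
        exact ⟨0, fun i hi => absurd (h i) hi⟩
    obtain ⟨d, hd, he⟩ := exists_add_dir_mul p (u + p.dir) v
    refine ⟨u, v, ⟨hready, fun i hi => ?_, hu⟩, fun h => absurd h (by omega), fun _ _ _ =>
      ⟨d + 1, by rw [he]; push_cast; ring, by omega, by omega⟩⟩
    rw [hpos, walkPos, (hA i _).1 hi]
    exact (hD i).2.2.1
  have second : ∀ s ≤ n, NoHalt b κ C lam missing (7 * n + s) ∧
      Approach b κ C lam p R s (run (gatherProtocol b) κ C lam missing (7 * n + s)) := by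
    intro s
    induction s with
    | zero => exact fun _ => ⟨first _ (by omega), start⟩
    | succ s ih =>
      intro hs
      obtain ⟨hh, ha⟩ := ih (by omega)
      have hh' : NoHalt b κ C lam missing (7 * n + s + 1) := by
        rcases Nat.eq_zero_or_pos s with rfl | h1
        · exact first _ (by omega)
        · exact noHalt_succ hh (fun i hi =>
            ha.finishes_of_halt hN hp hb' hn h1 (by omega) hi) (hno _ (by omega) hh)
      exact ⟨hh', (ha.next hN hp (hh' _ (Nat.lt_succ_self _)) _).resolve_left
        (hno (7 * n + s + 1) (by omega) hh')⟩
  obtain ⟨hh, ha⟩ := second n le_rfl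
  exact hno (7 * n + n) (by omega) hh (ha.finishes hN)

theorem run_of_finishes {t : ℕ}
    (hf : Finishes b κ C lam (run (gatherProtocol b) κ C lam missing t)) (s : ℕ) (i : Fin k) :
    (run (gatherProtocol b) κ C lam missing (t + 1 + s) i).mem = none ∧
      (run (gatherProtocol b) κ C lam missing (t + 1 + s) i).pos =
        (run (gatherProtocol b) κ C lam missing t i).pos := by
  induction s with
  | zero =>
    have := nextRound_of_halt (e := missing t) (hf.1 i)
    exact ⟨congrArg Agent.mem this, (congrArg Agent.pos this :)⟩
  | succ s ih =>
    have := nextRound_of_halt (b := b) (κ := κ) (C := C) (lam := lam)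
      (e := missing (t + 1 + s)) (decision_of_mem_none ih.1)
    exact ⟨congrArg Agent.mem this, (congrArg Agent.pos this).trans ih.2⟩

theorem mem_ne_none_of_noHalt {t : ℕ} (hh : NoHalt b κ C lam missing t) (i : Fin k) :
    (run (gatherProtocol b) κ C lam missing t i).mem ≠ none := by
  cases t with
  | zero => simp [run]
  | succ t =>
    rw [run, nextRound_mem, Ne, Option.map_eq_none_iff]
    exact hh t (Nat.lt_succ_self t) i

theorem solvesGathering_of_finishes {t T : ℕ} (hh : NoHalt b κ C lam missing t)
    (hf : Finishes b κ C lam (run (gatherProtocol b) κ C lam missing t)) (hT : t + 1 ≤ T) :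
    SolvesGathering (gatherProtocol b) κ C lam missing T := by
  have later : ∀ s, Gathered (run (gatherProtocol b) κ C lam missing (t + 1 + s)) := by
    intro s
    obtain ⟨v, hv⟩ := hf.2
    exact ⟨v, fun i => by rw [(run_of_finishes hf s i).2]; exact hv i⟩
  refine ⟨⟨t + 1, hT, fun i => (run_of_finishes hf 0 i).1, later 0⟩, fun r i hr => ?_⟩
  by_cases hle : r ≤ t
  · exact absurd hr (mem_ne_none_of_noHalt (fun s hs => hh s (by omega)) i)
  · obtain ⟨s, rfl⟩ := Nat.exists_eq_add_of_le (show t + 1 ≤ r by omega)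
    exact later s

theorem gatherProtocol_solvesGathering [NeZero n] (hn : 3 ≤ n) (hC : ¬ C.IsPeriodic) (hlam : Chirality lam)
    (hb : b = true → κ = n) (hb' : b = false → κ = k) :
    SolvesGathering (gatherProtocol b) κ C lam missing (9 * n) := by
  rcases Nat.eq_zero_or_pos k with rfl | hk
  · exact ⟨⟨0, Nat.zero_le _, fun i => i.elim0, 0, fun i => i.elim0⟩, fun _ i => i.elim0⟩
  · obtain ⟨t, ht, hh, hf⟩ := exists_finishes (missing := missing) (by omega) hk hC hlam hb hb'
    exact solvesGathering_of_finishes hh hf (by omega)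

end Execution

end DynRing

theorem mainTheorem5 :
    (∃ (A : DynRing.Protocol) (c : ℕ), ∀ (n k : ℕ), 3 ≤ n →
      ∀ (C : DynRing.Config n k) (lam : DynRing.Orientations k) (missing : DynRing.Schedule n),
        DynRing.Chirality lam → ¬ C.IsPeriodic →
          DynRing.SolvesGathering A n C lam missing (c * n)) ∧
    (∃ (A : DynRing.Protocol) (c : ℕ), ∀ (n k : ℕ), 3 ≤ n →
      ∀ (C : DynRing.Config n k) (lam : DynRing.Orientations k) (missing : DynRing.Schedule n),
        DynRing.Chirality lam → ¬ C.IsPeriodic →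
          DynRing.SolvesGathering A k C lam missing (c * n)) := by
  refine ⟨⟨DynRing.gatherProtocol true, 9, fun n k hn C lam missing hlam hC => ?_⟩,
    ⟨DynRing.gatherProtocol false, 9, fun n k hn C lam missing hlam hC => ?_⟩⟩ <;>
  have : NeZero n := ⟨by omega⟩
  · exact DynRing.gatherProtocol_solvesGathering hn hC hlam (fun _ => rfl) nofun
  · exact DynRing.gatherProtocol_solvesGathering hn hC hlam nofun fun _ => rfl
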